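/- **Theorem 2.3 (multisymplectic form formula).** Let $\sigma\in\mathbb R$, let $X\subseteq\mathbb R^3$ be open with coordinates $(x,y,t)$, and let $Y=X\times\mathbb R\to X$ be the trivial line bundle, whose smooth sections are the smooth functions $\varphi:X\to\mathbb R$. Let $J^5(Y)$ be the fifth jet bundle, with coordinates $x,y,t$ and $\varphi_J$ ($J$ a multi-index in $x,y,t$ with $|J|\le 5$), and let $j^5(\varphi)$ be the fifth jet prolongation of a section $\varphi$. For the Lagrangian density $$L=\bigl(\varphi_{xx}\varphi_{xt}-\tfrac12\varphi_{xxx}^2+\tfrac{\sigma}{2}\varphi_{xy}^2+\varphi_{xx}^3\bigr)\,dx\wedge dy\wedge dt$$ of the KP equation in potential form, $2\varphi_{xxxt}+6\varphi_{xx}\varphi_{xxxx}+6\varphi_{xxx}^2+\varphi_{xxxxxx}+\sigma\varphi_{xxyy}=0$ (where $u=\varphi_{xx}$), let $\theta_L$ be the Cartan form on $J^5(Y)$ $$\begin{aligned}\theta_L={}&\bigl(\tfrac12\varphi_{xxx}^2-\tfrac{\sigma}{2}\varphi_{xy}^2+2\varphi_x\varphi_{xxt}+6\varphi_x\varphi_{xx}\varphi_{xxx}+\sigma\varphi_x\varphi_{xyy}+\varphi_x\varphi_{xxxxx}-\varphi_{xx}\varphi_{xt}-2\varphi_{xx}^3-\varphi_{xx}\varphi_{xxxx}\bigr)\,dx\wedge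 dy\wedge dt\\&+(-2\varphi_{xxt}-6\varphi_{xx}\varphi_{xxx}-\sigma\varphi_{xyy}-\varphi_{xxxxx})\,d\varphi\wedge dy\wedge dt+(\varphi_{xt}+3\varphi_{xx}^2+\varphi_{xxxx})\,d\varphi_x\wedge dy\wedge dt\\&-\varphi_{xxx}\,d\varphi_{xx}\wedge dy\wedge dt-\sigma\varphi_{xy}\,d\varphi_x\wedge dx\wedge dt+\varphi_{xx}\,d\varphi_x\wedge dx\wedge dy,\end{aligned}$$ and let $\Omega_L=-d\theta_L$. A *solution* is a smooth section $\varphi$ over $X$ that satisfies the Euler–Lagrange equation $j^5(\varphi)^*(P\lrcorner\Omega_L)=0$ for every smooth vector field $P$ on $J^5(Y)$. Let $\eta_Y^\lambda$ and $\xi_Y^\lambda$ ($\lambda\in\mathbb R$) be two smooth one-parameter groups of automorphisms of the bundle $Y\to X$, covering $\eta_X^\lambda$ and $\xi_X^\lambda$, which are symmetry groups of the Euler–Lagrange equation: for every solution $\varphi$ and every $\lambda$, the sections $\eta_Y^\lambda\circ\varphi\circ(\eta_X^\lambda)^{-1}$ and $\xi_Y^\lambda\circ\varphi\circ(\xi_X^\lambda)^{-1}$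 are again solutions. Let $V$ and $W$ be their generating vector fields on $Y$, and let $j^5(V)$ and $j^5(W)$ be the prolongations of these to $J^5(Y)$, i.e. the generators of the prolonged groups $j^5(\eta_Y^\lambda)$ and $j^5(\xi_Y^\lambda)$, where $j^5(\eta_Y^\lambda)$ maps $j^5(\psi)(p)$ to $j^5\bigl(\eta_Y^\lambda\circ\psi\circ(\eta_X^\lambda)^{-1}\bigr)(\eta_X^\lambda(p))$. Then for every solution $\varphi$ and every bounded open set $U$ with $\overline U\subseteq X$ whose closure is a $C^2$ domain with corners (that is, near each point of $\overline U$, after an orientation-preserving $C^2$ change of coordinates, $U$ is given by $z_j<0$ for all $j$ in some subset of the three coordinate indices), $$\int_{\partial U} j^5(\varphi)^*\bigl(j^5(V)\lrcorner j^5(W)\lrcorner\Omega_L\bigr)=0,$$ where $\partial U$ has the boundary orientation. -/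

import Mathlib

open Set MeasureTheory
open scoped ContDiff

noncomputable section

namespace KP

/-- Space-time `ℝ³` with coordinates `(x, y, t) = (p 0, p 1, p 2)`. -/
abbrev Base : Type := Fin 3 → ℝ

/-- Multi-indices `(a, b, c)` with `a + b + c ≤ 5`; they label the jet coordinate
`∂ₓᵃ ∂ᵧᵇ ∂ₜᶜ φ`. -/
abbrev Idx : Type := {J : Fin 3 → Fin 6 // ∑ i, (J i : ℕ) ≤ 5}

/-- The multi-index `(a, b, c)`. -/
def mi (a b c : Fin 6) (h : (a : ℕ) + b + c ≤ 5 := by decide) : Idx :=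
  ⟨![a, b, c], by simpa [Fin.sum_univ_three] using h⟩

/-- The fifth jet bundle of the trivial line bundle `ℝ³ × ℝ → ℝ³`, in its global coordinates:
a base point and the `56` values `φ_J`, `|J| ≤ 5`. For an open `X ⊆ ℝ³`, the jets over `X` are
the `z` with `z.1 ∈ X`. -/
abbrev J5 : Type := Base × (Idx → ℝ)

/-! ### Jets of sections -/

/-- Partial derivative in the `i`-th coordinate. -/
def pd (i : Fin 3) (f : Base → ℝ) (p : Base) : ℝ := fderiv ℝ f p (Pi.single i 1)

/-- The partial derivative `∂^J f`. -/
def pdJ (J : Idx) (f : Base → ℝ) : Base → ℝ :=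
  (pd 0)^[(J.1 0 : ℕ)] ((pd 1)^[(J.1 1 : ℕ)] ((pd 2)^[(J.1 2 : ℕ)] f))

/-- The fifth jet prolongation `j⁵(φ)`. -/
def jet (φ : Base → ℝ) (p : Base) : J5 := (p, fun J => pdJ J φ p)

/-- The polynomial section whose fifth jet at the point `z.1` is `z`. -/
def taylor (z : J5) (q : Base) : ℝ :=
  ∑ J : Idx, z.2 J * ∏ i, (q i - z.1 i) ^ (J.1 i : ℕ) / (Nat.factorial (J.1 i : ℕ) : ℝ)

/-! ### Differential forms -/

/-- Interior product `V ⌟ β`. -/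
def contract {E : Type*} [NormedAddCommGroup E] [NormedSpace ℝ E] {n : ℕ}
    (V : E → E) (β : E → E [⋀^Fin (n + 1)]→L[ℝ] ℝ) : E → E [⋀^Fin n]→L[ℝ] ℝ :=
  fun z => (β z).curryLeft (V z)

/-- Pull-back `f^* β`. -/
def pullback {E F : Type*} [NormedAddCommGroup E] [NormedSpace ℝ E]
    [NormedAddCommGroup F] [NormedSpace ℝ F] {n : ℕ}
    (f : E → F) (β : F → F [⋀^Fin n]→L[ℝ] ℝ) : E → E [⋀^Fin n]→L[ℝ] ℝ :=
  fun p => (β (f p)).compContinuousLinearMap (fderiv ℝ f p)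

/-- The wedge product `a ∧ b ∧ c` of three covectors, so that
`(a ∧ b ∧ c) (v₀, v₁, v₂) = det (![a, b, c] i (v j))`. -/
def wedge3 (a b c : J5 →L[ℝ] ℝ) : J5 [⋀^Fin 3]→L[ℝ] ℝ :=
  ContinuousMultilinearMap.alternatization
    ((ContinuousMultilinearMap.mkPiAlgebra ℝ (Fin 3) ℝ).compContinuousLinearMap ![a, b, c])

/-- The covectors `dx, dy, dt` on the jet bundle. -/
def dX (i : Fin 3) : J5 →L[ℝ] ℝ :=
  (ContinuousLinearMap.proj i).comp (ContinuousLinearMap.fst ℝ Base (Idx → ℝ))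

/-- The covector `dφ_J` on the jet bundle. -/
def dPhi (J : Idx) : J5 →L[ℝ] ℝ :=
  (ContinuousLinearMap.proj J).comp (ContinuousLinearMap.snd ℝ Base (Idx → ℝ))

/-- The Cartan form `θ_L` of the Lagrangian density
`(φ_xx φ_xt - φ_xxx² / 2 + (σ / 2) φ_xy² + φ_xx³) dx ∧ dy ∧ dt`. -/
def theta (σ : ℝ) (z : J5) : J5 [⋀^Fin 3]→L[ℝ] ℝ :=
  let φx := z.2 (mi 1 0 0)
  let φxx := z.2 (mi 2 0 0)
  let φxy := z.2 (mi 1 1 0)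
  let φxt := z.2 (mi 1 0 1)
  let φxxx := z.2 (mi 3 0 0)
  let φxxt := z.2 (mi 2 0 1)
  let φxyy := z.2 (mi 1 2 0)
  let φxxxx := z.2 (mi 4 0 0)
  let φxxxxx := z.2 (mi 5 0 0)
  let dx := dX 0
  let dy := dX 1
  let dt := dX 2
  let dφ := dPhi (mi 0 0 0)
  let dφx := dPhi (mi 1 0 0)
  let dφxx := dPhi (mi 2 0 0)
  (1 / 2 * φxxx ^ 2 - σ / 2 * φxy ^ 2 + 2 * φx * φxxt + 6 * φx * φxx * φxxx
      + σ * φx * φxyy + φx * φxxxxx - φxx * φxt - 2 * φxx ^ 3 - φxx * φxxxx) • wedge3 dx dy dt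
    + (-2 * φxxt - 6 * φxx * φxxx - σ * φxyy - φxxxxx) • wedge3 dφ dy dt
    + (φxt + 3 * φxx ^ 2 + φxxxx) • wedge3 dφx dy dt
    - φxxx • wedge3 dφxx dy dt
    - (σ * φxy) • wedge3 dφx dx dt
    + φxx • wedge3 dφx dx dy

/-- The multisymplectic form `Ω_L = -dθ_L`. -/
def Omega (σ : ℝ) (z : J5) : J5 [⋀^Fin 4]→L[ℝ] ℝ := -extDeriv (theta σ) z

/-- `φ` is a smooth section over the open set `X` which solves the Euler–Lagrange equation
`j⁵(φ)^* (W ⌟ Ω_L) = 0` for all smooth vector fields `W` on the fifth jet bundle over `X`. -/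
def IsSolution (σ : ℝ) (X : Set Base) (φ : Base → ℝ) : Prop :=
  ContDiffOn ℝ ∞ φ X ∧
    ∀ W : J5 → J5, ContDiffOn ℝ ∞ W {z | z.1 ∈ X} →
      ∀ p ∈ X, pullback (jet φ) (contract W (Omega σ)) p = 0

/-! ### One-parameter groups of bundle automorphisms -/

/-- A smooth one-parameter group `η_Y^s (p, u) = (base s p, fib s p u)`, `s ∈ ℝ`, of automorphisms
of the bundle `X × ℝ → X`, covering `η_X^s = base s`. -/
structure OneParamGroup (X : Set Base) where
  base : ℝ → Base → Base
  fib : ℝ → Base → ℝ → ℝ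
  mapsTo : ∀ s, MapsTo (base s) X X
  contDiffOn_base : ContDiffOn ℝ ∞ (fun q : ℝ × Base => base q.1 q.2) (univ ×ˢ X)
  contDiffOn_fib :
    ContDiffOn ℝ ∞ (fun q : ℝ × Base × ℝ => fib q.1 q.2.1 q.2.2) (univ ×ˢ X ×ˢ univ)
  base_zero : ∀ p ∈ X, base 0 p = p
  fib_zero : ∀ p ∈ X, ∀ u, fib 0 p u = u
  base_add : ∀ r s, ∀ p ∈ X, base (r + s) p = base r (base s p)
  fib_add : ∀ r s, ∀ p ∈ X, ∀ u, fib (r + s) p u = fib r (base s p) (fib s p u)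

namespace OneParamGroup

variable {X : Set Base}

/-- The transformed section `η_Y^s ∘ φ ∘ (η_X^s)⁻¹`; note `(η_X^s)⁻¹ = η_X^(-s)`. -/
def act (η : OneParamGroup X) (s : ℝ) (φ : Base → ℝ) (p : Base) : ℝ :=
  η.fib s (η.base (-s) p) (φ (η.base (-s) p))

/-- The prolongation `j⁵(η_Y^s)` to the jet bundle: a jet `z = j⁵(ψ)(p)` is sent to the jet at
`η_X^s p` of the transformed section `η_Y^s ∘ ψ ∘ (η_X^s)⁻¹`, where `ψ` is the polynomial
representative of `z`. -/
def prolong (η : OneParamGroup X) (s : ℝ) (z : J5) : J5 :=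
  jet (η.act s (taylor z)) (η.base s z.1)

/-- The prolonged vector field `j⁵(V)`, where `V` generates `η_Y^s`: the infinitesimal generator
of the prolonged group `j⁵(η_Y^s)`. -/
def jetGenerator (η : OneParamGroup X) (z : J5) : J5 := deriv (fun s => η.prolong s z) 0

/-- `η` is a symmetry group of the Euler–Lagrange equation: it maps solutions to solutions. -/
def IsSymmetry (σ : ℝ) (η : OneParamGroup X) : Prop :=
  ∀ φ : Base → ℝ, IsSolution σ X φ → ∀ s, IsSolution σ X (η.act s φ)

end OneParamGroup

/-! ### Integration over the boundary of a domain -/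

/-- A finite oriented `C²` atlas of `closure U`, as a domain with corners in `ℝ³`, together with a
partition of unity subordinate to it. In the chart `i` the set `U` is
`{z | z j < 0 for all j ∈ S i}`: thus `S i = ∅` for an interior chart, `S i` has one element at a
smooth boundary point, two at an edge and three at a vertex. -/
structure CornerAtlas (U : Set Base) where
  n : ℕ
  chart : Fin n → OpenPartialHomeomorph Base Base
  S : Fin n → Finset (Fin 3)
  rho : Fin n → Base → ℝ
  contDiffOn_chart : ∀ i, ContDiffOn ℝ 2 (chart i) (chart i).source
  det_pos : ∀ i, ∀ z ∈ (chart i).source, 0 < (fderiv ℝ (chart i) z).det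
  mem_iff : ∀ i, ∀ z ∈ (chart i).source, chart i z ∈ U ↔ ∀ j ∈ S i, z j < 0
  contDiff_rho : ∀ i, ContDiff ℝ 1 (rho i)
  hasCompactSupport_rho : ∀ i, HasCompactSupport (rho i)
  tsupport_rho : ∀ i, tsupport (rho i) ⊆ (chart i).target
  sum_rho : ∀ p ∈ closure U, ∑ i, rho i p = 1

/-- The integral `∫_{∂U} α` of a 2-form for the boundary orientation: in the chart `i`, the boundary
is the union over `j ∈ S i` of the faces `{z j = 0}`, on which the outward-normal-first
orientation is `(-1)^j` times that of the remaining two coordinates. -/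
def CornerAtlas.boundaryIntegral {U : Set Base} (A : CornerAtlas U)
    (α : Base → Base [⋀^Fin 2]→L[ℝ] ℝ) : ℝ :=
  ∑ i, ∑ j ∈ A.S i, (-1 : ℝ) ^ (j : ℕ) *
    ∫ w in {w : Fin 2 → ℝ | j.insertNth 0 w ∈ (A.chart i).source ∧
        ∀ k ∈ A.S i, k ≠ j → (j.insertNth 0 w : Base) k < 0},
      A.rho i (A.chart i (j.insertNth 0 w)) *
        pullback (A.chart i) α (j.insertNth 0 w) (fun k => Pi.single (j.succAbove k) 1)

end KP

end

/-!
Write `F (r, s, p) = j⁵(η_Y^r) (j⁵(ξ_Y^s) (j⁵(φ) p))`. For fixed `(r, s)` this is the jet of the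
transformed section precomposed with a diffeomorphism of `X`, and that section is again a solution;
so every contraction of `F^* Ω` vanishes on vectors tangent to `X`, for all `(r, s)` and not only at
the origin. As `F^* Ω` is closed, Cartan's formula for the constant fields `∂_s` and `∂_r` shows
that the restriction of `∂_r ⌟ ∂_s ⌟ F^* Ω` to `{(0, 0)} × X` is closed. This restriction is
`j⁵(φ)^* (j⁵(V) ⌟ j⁵(W) ⌟ Ω)`, and Stokes' theorem on domains with corners concludes.
-/

noncomputable section

namespace KP

/-! ### Stokes' theorem on domains with corners -/

theorem hasDerivAt_insertNth {n : ℕ} (j : Fin (n + 1)) (w : Fin n → ℝ) (r : ℝ) :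
    HasDerivAt (fun r : ℝ => (j.insertNth r w : Fin (n + 1) → ℝ)) (Pi.single j 1) r := by
  rw [hasDerivAt_pi]
  refine j.forall_iff_succAbove.2 ⟨?_, fun k => ?_⟩
  · simpa using hasDerivAt_id' r
  · simpa using hasDerivAt_const r (w k)

theorem contDiff_insertNth {n : ℕ} (j : Fin (n + 1)) (w : Fin n → ℝ) {m : WithTop ℕ∞} :
    ContDiff ℝ m (fun r : ℝ => (j.insertNth r w : Fin (n + 1) → ℝ)) := by
  rw [contDiff_pi]
  refine j.forall_iff_succAbove.2 ⟨?_, fun k => ?_⟩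
  · simpa using contDiff_fun_id
  · simpa using contDiff_const

theorem hasCompactSupport_comp_insertNth {n : ℕ} {F : Type*} [Zero F]
    {f : (Fin (n + 1) → ℝ) → F} (hf : HasCompactSupport f) (j : Fin (n + 1)) (w : Fin n → ℝ) :
    HasCompactSupport (fun r : ℝ => f (j.insertNth r w)) := by
  refine HasCompactSupport.intro (K := (fun z : Fin (n + 1) → ℝ => z j) '' tsupport f)
    (hf.isCompact.image (continuous_apply j)) fun r hr => ?_
  by_contra h
  exact hr ⟨_, subset_tsupport f h, by simp⟩

/-- The sector `{z | z k < 0 for all k ∈ S}` of `ℝⁿ`: the model of a domain with corners. -/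
def quadrant {n : ℕ} (S : Finset (Fin n)) : Set (Fin n → ℝ) := {z | ∀ k ∈ S, z k < 0}

/-- The face `{z j = 0}` of `quadrant S`, in the coordinates `z k`, `k ≠ j`. -/
def face {n : ℕ} (S : Finset (Fin (n + 1))) (j : Fin (n + 1)) : Set (Fin n → ℝ) :=
  {w | ∀ k ∈ S, k ≠ j → (j.insertNth 0 w : Fin (n + 1) → ℝ) k < 0}

theorem isOpen_quadrant {n : ℕ} (S : Finset (Fin n)) : IsOpen (quadrant S) :=
  isOpen_set_pi S.finite_toSet fun _ _ => isOpen_Iio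

theorem isOpen_face {n : ℕ} (S : Finset (Fin (n + 1))) (j : Fin (n + 1)) : IsOpen (face S j) := by
  have : face S j = (fun w => (j.insertNth 0 w : Fin (n + 1) → ℝ)) ⁻¹' quadrant (S.erase j) := by
    ext w
    simp [face, quadrant, and_imp, imp.swap]
  rw [this]
  exact (isOpen_quadrant _).preimage (continuous_const.finInsertNth j continuous_id)

theorem insertNth_mem_quadrant {n : ℕ} {S : Finset (Fin (n + 1))} {j : Fin (n + 1)} {r : ℝ}
    {w : Fin n → ℝ} :
    (j.insertNth r w : Fin (n + 1) → ℝ) ∈ quadrant S ↔ (j ∈ S → r < 0) ∧ w ∈ face S j := by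
  simp [quadrant, face, j.forall_iff_succAbove, Fin.succAbove_ne]

theorem setIntegral_quadrant {n : ℕ} {F : Type*} [NormedAddCommGroup F] [NormedSpace ℝ F]
    {g : (Fin (n + 1) → ℝ) → F} {S : Finset (Fin (n + 1))} (hg : IntegrableOn g (quadrant S))
    (j : Fin (n + 1)) :
    ∫ z in quadrant S, g z =
      ∫ w in face S j, ∫ r in {r : ℝ | j ∈ S → r < 0}, g (j.insertNth r w) := by
  let e := (MeasurableEquiv.piFinSuccAbove (fun _ : Fin (n + 1) => ℝ) j).symm
  have he : MeasurePreserving e := (volume_preserving_piFinSuccAbove (fun _ => ℝ) j).symm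
  have hpre : e ⁻¹' quadrant S = {r : ℝ | j ∈ S → r < 0} ×ˢ face S j :=
    Set.ext fun x => insertNth_mem_quadrant (r := x.1) (w := x.2)
  rw [← he.integrableOn_comp_preimage e.measurableEmbedding, hpre, Measure.volume_eq_prod] at hg
  rw [← he.setIntegral_preimage_emb e.measurableEmbedding, hpre, Measure.volume_eq_prod,
    ← setIntegral_prod_swap]
  exact setIntegral_prod _ hg.swap

theorem setIntegral_deriv_of_hasCompactSupport {F : Type*} [NormedAddCommGroup F]
    [NormedSpace ℝ F] [CompleteSpace F] {f : ℝ → F} (hf : ContDiff ℝ 1 f)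
    (hc : HasCompactSupport f) (P : Prop) [Decidable P] :
    ∫ r in {r : ℝ | P → r < 0}, deriv f r = if P then f 0 else 0 := by
  split_ifs with hP
  · simp only [hP, forall_const]
    exact (integral_Iic_eq_integral_Iio).symm.trans (hc.integral_Iic_deriv_eq hf 0)
  · simp only [hP, false_imp_iff, ofPred_true, Measure.restrict_univ]
    exact integral_eq_zero_of_hasDerivAt_of_integrable
      (fun r => (hf.differentiable one_ne_zero r).hasDerivAt)
      ((hf.continuous_deriv le_rfl).integrable_of_hasCompactSupport hc.deriv)
      (hf.continuous.integrable_of_hasCompactSupport hc)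

theorem setIntegral_quadrant_fderiv {n : ℕ} {F : Type*} [NormedAddCommGroup F]
    [NormedSpace ℝ F] [CompleteSpace F] {f : (Fin (n + 1) → ℝ) → F} (hf : ContDiff ℝ 1 f)
    (hc : HasCompactSupport f) (S : Finset (Fin (n + 1))) (j : Fin (n + 1)) :
    ∫ z in quadrant S, fderiv ℝ f z (Pi.single j 1) =
      if j ∈ S then ∫ w in face S j, f (j.insertNth 0 w) else 0 := by
  have hderiv (w : Fin n → ℝ) (r : ℝ) :
      deriv (fun r : ℝ => f (j.insertNth r w)) r = fderiv ℝ f (j.insertNth r w) (Pi.single j 1) :=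
    ((hf.differentiable one_ne_zero _).hasFDerivAt.comp_hasDerivAt r
      (hasDerivAt_insertNth j w r)).deriv
  have hint : Integrable fun z => fderiv ℝ f z (Pi.single j 1) :=
    ((hf.continuous_fderiv one_ne_zero).clm_apply
      continuous_const).integrable_of_hasCompactSupport (hc.fderiv_apply (𝕜 := ℝ) _)
  have hinner (w : Fin n → ℝ) : ∫ r in {r : ℝ | j ∈ S → r < 0},
      fderiv ℝ f (j.insertNth r w) (Pi.single j 1) = if j ∈ S then f (j.insertNth 0 w) else 0 := by
    simp only [← hderiv]
    exact setIntegral_deriv_of_hasCompactSupport (hf.comp (contDiff_insertNth j w))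
      (hasCompactSupport_comp_insertNth hc j w) (j ∈ S)
  rw [setIntegral_quadrant hint.integrableOn j]
  simp only [hinner]
  split_ifs <;> simp

/-- The standard frame of `ℝⁿ`. -/
def frame (n : ℕ) : Fin n → Fin n → ℝ := fun k => Pi.single k 1

theorem setIntegral_quadrant_extDeriv {n : ℕ}
    {β : (Fin (n + 1) → ℝ) → (Fin (n + 1) → ℝ) [⋀^Fin n]→L[ℝ] ℝ} (hβ : ContDiff ℝ 1 β)
    (hc : HasCompactSupport β) (S : Finset (Fin (n + 1))) :
    ∫ z in quadrant S, extDeriv β z (frame (n + 1)) =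
      ∑ j ∈ S, (-1 : ℝ) ^ (j : ℕ) *
        ∫ w in face S j, β (j.insertNth 0 w) (j.removeNth (frame (n + 1))) := by
  have hsmooth (v) : ContDiff ℝ 1 (fun z => β z v) :=
    (ContinuousAlternatingMap.apply ℝ (Fin (n + 1) → ℝ) ℝ v).contDiff.comp hβ
  have hsupp (v) : HasCompactSupport (fun z => β z v) :=
    hc.comp_left (g := fun b : (Fin (n + 1) → ℝ) [⋀^Fin n]→L[ℝ] ℝ => b v) rfl
  have hint (v) (j : Fin (n + 1)) :
      Integrable fun z => fderiv ℝ (fun z => β z v) z (Pi.single j 1) :=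
    (((hsmooth v).continuous_fderiv one_ne_zero).clm_apply
      continuous_const).integrable_of_hasCompactSupport ((hsupp v).fderiv_apply (𝕜 := ℝ) _)
  calc ∫ z in quadrant S, extDeriv β z (frame (n + 1))
      = ∫ z in quadrant S, ∑ j : Fin (n + 1), (-1 : ℝ) ^ (j : ℕ) *
          fderiv ℝ (fun z => β z (j.removeNth (frame (n + 1)))) z (Pi.single j 1) := by
        simp [extDeriv_apply (hβ.differentiable one_ne_zero _), frame]
    _ = ∑ j : Fin (n + 1), if j ∈ S then (-1 : ℝ) ^ (j : ℕ) *
          ∫ w in face S j, β (j.insertNth 0 w) (j.removeNth (frame (n + 1))) else 0 := by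
        rw [integral_finsetSum _ fun j _ => ((hint _ j).const_mul _).integrableOn]
        simp only [integral_const_mul, mul_ite, mul_zero,
          setIntegral_quadrant_fderiv (hsmooth _) (hsupp _)]
    _ = _ := by simp

section Forms

variable {D E F G : Type*} [NormedAddCommGroup D] [NormedSpace ℝ D]
  [NormedAddCommGroup E] [NormedSpace ℝ E] [NormedAddCommGroup F] [NormedSpace ℝ F]
  [NormedAddCommGroup G] [NormedSpace ℝ G] {m : WithTop ℕ∞} {n : ℕ}

theorem norm_alternatization_le (f : ContinuousMultilinearMap ℝ (fun _ : Fin n => E) G) :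
    ‖ContinuousMultilinearMap.alternatization f‖ ≤ n.factorial * ‖f‖ := by
  refine ContinuousAlternatingMap.opNorm_le_bound _ (by positivity) fun v => ?_
  have hterm (σ : Equiv.Perm (Fin n)) : ‖Equiv.Perm.sign σ • f (v ∘ σ)‖ ≤ ‖f‖ * ∏ i, ‖v i‖ := by
    have hsign : ‖Equiv.Perm.sign σ • f (v ∘ σ)‖ = ‖f (v ∘ σ)‖ := by
      rcases Int.units_eq_one_or (Equiv.Perm.sign σ) with h | h <;> simp [h]
    rw [hsign, ← Equiv.prod_comp σ fun i => ‖v i‖]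
    exact f.le_opNorm (v ∘ σ)
  rw [ContinuousMultilinearMap.alternatization_apply_apply]
  refine (norm_sum_le_of_le _ fun σ _ => hterm σ).trans_eq ?_
  simp [Fintype.card_perm, mul_assoc]

/-- Alternatization of continuous multilinear maps, as a continuous linear map. -/
def alternatizationCLM (n : ℕ) (E G : Type*) [NormedAddCommGroup E] [NormedSpace ℝ E]
    [NormedAddCommGroup G] [NormedSpace ℝ G] :
    ContinuousMultilinearMap ℝ (fun _ : Fin n => E) G →L[ℝ] E [⋀^Fin n]→L[ℝ] G :=
  LinearMap.mkContinuous
    { toFun := ContinuousMultilinearMap.alternatization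
      map_add' := map_add _
      map_smul' := fun c f => by
        ext v
        simp [ContinuousMultilinearMap.alternatization_apply_apply, Finset.smul_sum,
          smul_comm c] }
    n.factorial norm_alternatization_le

theorem alternatizationCLM_toContinuousMultilinearMap (a : E [⋀^Fin n]→L[ℝ] G) :
    alternatizationCLM n E G a.toContinuousMultilinearMap = (n.factorial : ℝ) • a := by
  ext v
  have h := congrArg (fun b => b v) (AlternatingMap.coe_alternatization a.toAlternatingMap)
  simpa [alternatizationCLM, ContinuousMultilinearMap.alternatization_apply_apply,
    MultilinearMap.alternatization_apply, Nat.cast_smul_eq_nsmul, Function.comp_def] using h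

theorem contDiffAt_of_toContinuousMultilinearMap {a : D → E [⋀^Fin n]→L[ℝ] G} {x : D}
    (h : ContDiffAt ℝ m (fun y => (a y).toContinuousMultilinearMap) x) : ContDiffAt ℝ m a x := by
  have ha : a = fun y => (n.factorial : ℝ)⁻¹ •
      alternatizationCLM n E G (a y).toContinuousMultilinearMap := by
    funext y
    rw [alternatizationCLM_toContinuousMultilinearMap,
      inv_smul_smul₀ (Nat.cast_ne_zero.2 n.factorial_ne_zero)]
  rw [ha]
  exact ((alternatizationCLM n E G).contDiff.contDiffAt.comp x h).const_smul _

theorem contDiffAt_compContinuousLinearMap [CompleteSpace G]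
    {a : D → F [⋀^Fin n]→L[ℝ] G} {T : D → E →L[ℝ] F} {x : D}
    (ha : ContDiffAt ℝ m a x) (hT : ContDiffAt ℝ m T x) :
    ContDiffAt ℝ m (fun y => (a y).compContinuousLinearMap (T y)) x := by
  refine contDiffAt_of_toContinuousMultilinearMap ?_
  have hpair : ContDiffAt ℝ m (fun y => ((fun _ : Fin n => T y),
      ContinuousAlternatingMap.toContinuousMultilinearMapCLM ℝ (a y))) x :=
    (contDiffAt_pi.2 fun _ => hT).prodMk
      ((ContinuousAlternatingMap.toContinuousMultilinearMapCLM
        ℝ : (F [⋀^Fin n]→L[ℝ] G) →L[ℝ] _).contDiff.contDiffAt.comp x ha)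
  exact (ContinuousMultilinearMap.analyticAt_uncurry_compContinuousLinearMap
    (𝕜 := ℝ) (Fm := fun _ : Fin n => E) (Em := fun _ : Fin n => F) (G := G)).contDiffAt.comp x hpair

theorem contDiffAt_pullback {f : E → F} {β : F → F [⋀^Fin n]→L[ℝ] ℝ} {x : E}
    (hf : ContDiffAt ℝ (m + 1) f x) (hβ : ContDiffAt ℝ m β (f x)) :
    ContDiffAt ℝ m (pullback f β) x :=
  contDiffAt_compContinuousLinearMap (hβ.comp x (hf.of_le le_self_add)) (hf.fderiv_right le_rfl)

theorem extDeriv_zero (x : E) : extDeriv (0 : E → E [⋀^Fin n]→L[ℝ] G) x = 0 := by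
  ext v
  simp [extDeriv, ContinuousAlternatingMap.alternatizeUncurryFin_apply]

theorem extDeriv_eq_zero_of_notMem_tsupport {β : E → E [⋀^Fin n]→L[ℝ] G} {x : E}
    (hx : x ∉ tsupport β) : extDeriv β x = 0 :=
  (notMem_tsupport_iff_eventuallyEq.1 hx).extDeriv_eq.trans (extDeriv_zero x)

end Forms

theorem contDiff_of_tsupport {E F : Type*} [NormedAddCommGroup E] [NormedSpace ℝ E]
    [NormedAddCommGroup F] [NormedSpace ℝ F] {m : WithTop ℕ∞} {f : E → F}
    (h : ∀ x ∈ tsupport f, ContDiffAt ℝ m f x) : ContDiff ℝ m f :=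
  (contMDiff_of_tsupport fun x hx => (h x hx).contMDiffAt).contDiff

theorem exists_cutoff {E : Type*} [NormedAddCommGroup E] [NormedSpace ℝ E] [FiniteDimensional ℝ E]
    {K X : Set E} (hK : IsClosed K) (hX : IsOpen X) (h : K ⊆ X) {m : ℕ∞} :
    ∃ χ : E → ℝ, ContDiff ℝ m χ ∧ tsupport χ ⊆ X ∧ EqOn χ 1 K := by
  obtain ⟨W, hW, hKW, hWX⟩ := normal_exists_closure_subset hK hX h
  obtain ⟨χ, hχ, -, hsupp, hone⟩ := exists_contMDiff_support_eq_eq_one_iff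
    (n := m) (modelWithCornersSelf ℝ E) hW hK hKW
  exact ⟨χ, hχ.contDiff, by rwa [tsupport, hsupp], fun p hp => (hone p).1 hp⟩

theorem isCompact_symm_image {Y Z : Type*} [TopologicalSpace Y] [TopologicalSpace Z]
    (f : OpenPartialHomeomorph Y Z) {K : Set Z} (hK : IsCompact K) (h : K ⊆ f.target) :
    IsCompact (f.symm '' K) :=
  hK.image_of_continuousOn (f.continuousOn_symm.mono h)

section ChartPullback

variable {E F : Type*} [NormedAddCommGroup E] [NormedSpace ℝ E]
  [NormedAddCommGroup F] [NormedSpace ℝ F] {n : ℕ}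

/-- The pull-back of the form `β` by the chart `f`, extended by zero outside the source of `f`. -/
def chartPullback (f : OpenPartialHomeomorph E F) (β : F → F [⋀^Fin n]→L[ℝ] ℝ) :
    E → E [⋀^Fin n]→L[ℝ] ℝ :=
  f.source.indicator (pullback f β)

variable {f : OpenPartialHomeomorph E F} {β : F → F [⋀^Fin n]→L[ℝ] ℝ}

theorem chartPullback_eventuallyEq {z : E} (hz : z ∈ f.source) :
    chartPullback f β =ᶠ[nhds z] pullback f β :=
  Filter.eventuallyEq_of_mem (f.open_source.mem_nhds hz) fun _ hy => indicator_of_mem hy _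

theorem support_chartPullback_subset :
    Function.support (chartPullback f β) ⊆ f.symm '' tsupport β := by
  intro z hz
  have hzf : z ∈ f.source := mem_of_indicator_ne_zero hz
  refine ⟨f z, subset_tsupport β fun hβz => hz ?_, f.left_inv hzf⟩
  rw [chartPullback, indicator_of_mem hzf, pullback, hβz]
  rfl

theorem tsupport_chartPullback_subset (hc : HasCompactSupport β) (hs : tsupport β ⊆ f.target) :
    tsupport (chartPullback f β) ⊆ f.symm '' tsupport β :=
  closure_minimal support_chartPullback_subset (isCompact_symm_image f hc.isCompact hs).isClosed

theorem tsupport_chartPullback_subset_source (hc : HasCompactSupport β)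
    (hs : tsupport β ⊆ f.target) : tsupport (chartPullback f β) ⊆ f.source :=
  (tsupport_chartPullback_subset hc hs).trans
    (image_subset_iff.2 fun _ hy => f.map_target (hs hy))

theorem hasCompactSupport_chartPullback (hc : HasCompactSupport β) (hs : tsupport β ⊆ f.target) :
    HasCompactSupport (chartPullback f β) :=
  (isCompact_symm_image f hc.isCompact hs).of_isClosed_subset (isClosed_tsupport _)
    (tsupport_chartPullback_subset hc hs)

theorem contDiff_chartPullback {m : WithTop ℕ∞} (hf : ContDiffOn ℝ (m + 1) f f.source)
    (hβ : ContDiff ℝ m β) (hc : HasCompactSupport β) (hs : tsupport β ⊆ f.target) :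
    ContDiff ℝ m (chartPullback f β) :=
  contDiff_of_tsupport fun z hz => by
    have hzf := tsupport_chartPullback_subset_source hc hs hz
    exact (contDiffAt_pullback (hf.contDiffAt (f.open_source.mem_nhds hzf))
      hβ.contDiffAt).congr_of_eventuallyEq (chartPullback_eventuallyEq hzf)

theorem extDeriv_chartPullback (hf : ContDiffOn ℝ 2 f f.source) (hβ : ContDiff ℝ 1 β)
    {z : E} (hz : z ∈ f.source) :
    extDeriv (chartPullback f β) z = pullback f (extDeriv β) z := by
  rw [(chartPullback_eventuallyEq hz).extDeriv_eq]
  exact extDeriv_pullback (hβ.differentiable one_ne_zero (f z))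
    (hf.contDiffAt (f.open_source.mem_nhds hz)) (by simp)

end ChartPullback

theorem compContinuousLinearMap_frame {n : ℕ} (a : (Fin n → ℝ) [⋀^Fin n]→L[ℝ] ℝ)
    (T : (Fin n → ℝ) →L[ℝ] Fin n → ℝ) :
    a.compContinuousLinearMap T (frame n) = T.det * a (frame n) := by
  have hframe : ⇑(Pi.basisFun ℝ (Fin n)) = frame n := by ext; simp [frame]
  have ha := DFunLike.congr_fun (a.toAlternatingMap.eq_smul_basis_det (Pi.basisFun ℝ (Fin n)))
    (T ∘ frame n)
  have hdet := Module.Basis.det_comp (Pi.basisFun ℝ (Fin n)) (T : (Fin n → ℝ) →ₗ[ℝ] Fin n → ℝ)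
    (Pi.basisFun ℝ (Fin n))
  rw [Module.Basis.det_self, mul_one, hframe] at hdet
  rw [AlternatingMap.smul_apply, hframe, smul_eq_mul, mul_comm] at ha
  exact ha.trans (congrArg (· * a (frame n)) hdet)

theorem setIntegral_quadrant_extDeriv_chartPullback {n : ℕ}
    {f : OpenPartialHomeomorph (Fin (n + 1) → ℝ) (Fin (n + 1) → ℝ)}
    {β : (Fin (n + 1) → ℝ) → (Fin (n + 1) → ℝ) [⋀^Fin n]→L[ℝ] ℝ}
    (hf : ContDiffOn ℝ 2 f f.source) (hdet : ∀ z ∈ f.source, 0 < (fderiv ℝ f z).det)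
    {U : Set (Fin (n + 1) → ℝ)} (hU : MeasurableSet U) {S : Finset (Fin (n + 1))}
    (hS : ∀ z ∈ f.source, f z ∈ U ↔ z ∈ quadrant S)
    (hβ : ContDiff ℝ 1 β) (hc : HasCompactSupport β) (hs : tsupport β ⊆ f.target) :
    ∫ z in quadrant S, extDeriv (chartPullback f β) z (frame (n + 1)) =
      ∫ p in U, extDeriv β p (frame (n + 1)) := by
  have hmeas := f.open_source.measurableSet.inter (isOpen_quadrant S).measurableSet
  have himage : f '' (f.source ∩ quadrant S) = f.target ∩ U := by
    have : f.source ∩ quadrant S = f.source ∩ f ⁻¹' U :=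
      Set.ext fun z => and_congr_right fun hz => (hS z hz).symm
    rw [this, f.image_source_inter_eq', f.target_inter_inv_preimage_preimage]
  calc ∫ z in quadrant S, extDeriv (chartPullback f β) z (frame (n + 1))
      = ∫ z in f.source ∩ quadrant S, extDeriv (chartPullback f β) z (frame (n + 1)) := by
        refine setIntegral_eq_of_subset_of_forall_sdiff_eq_zero
          (isOpen_quadrant S).measurableSet inter_subset_right fun z hz => ?_
        rw [extDeriv_eq_zero_of_notMem_tsupport fun h =>
          hz.2 ⟨tsupport_chartPullback_subset_source hc hs h, hz.1⟩]
        rfl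
    _ = ∫ z in f.source ∩ quadrant S,
          |(fderiv ℝ f z).det| • extDeriv β (f z) (frame (n + 1)) := by
        refine setIntegral_congr_fun hmeas fun z hz => ?_
        rw [extDeriv_chartPullback hf hβ hz.1, abs_of_pos (hdet z hz.1)]
        exact compContinuousLinearMap_frame _ _
    _ = ∫ p in f.target ∩ U, extDeriv β p (frame (n + 1)) := by
        rw [← himage, integral_image_eq_integral_abs_det_fderiv_smul volume hmeas
          (fun z hz => ?_) (f.injOn.mono inter_subset_left)]
        exact ((hf.contDiffAt (f.open_source.mem_nhds hz.1)).differentiableAt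
          two_ne_zero).hasFDerivAt.hasFDerivWithinAt
    _ = ∫ p in U, extDeriv β p (frame (n + 1)) := by
        refine (setIntegral_eq_of_subset_of_forall_sdiff_eq_zero hU
          inter_subset_right fun p hp => ?_).symm
        rw [extDeriv_eq_zero_of_notMem_tsupport fun h => hp.2 ⟨hs h, hp.1⟩]
        rfl

theorem closure_quadrant {n : ℕ} (S : Finset (Fin n)) :
    closure (quadrant S) = {z | ∀ k ∈ S, z k ≤ 0} := by
  have := closure_pi_set (S : Set (Fin n)) fun _ => Iio (0 : ℝ)
  simp only [closure_Iio] at this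
  exact this

theorem insertNth_zero_mem_closure_quadrant {n : ℕ} {S : Finset (Fin (n + 1))}
    {j : Fin (n + 1)} {w : Fin n → ℝ} (hw : w ∈ face S j) :
    (j.insertNth 0 w : Fin (n + 1) → ℝ) ∈ closure (quadrant S) := by
  rw [closure_quadrant]
  intro k hk
  rcases eq_or_ne k j with rfl | hkj
  · simp
  · exact (hw k hk hkj).le

theorem continuous_extDeriv {E : Type*} [NormedAddCommGroup E] [NormedSpace ℝ E] {n : ℕ}
    {β : E → E [⋀^Fin n]→L[ℝ] ℝ} (hβ : ContDiff ℝ 1 β) : Continuous (extDeriv β) :=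
  (ContinuousAlternatingMap.alternatizeUncurryFinCLM ℝ E ℝ).continuous.comp
    (hβ.continuous_fderiv one_ne_zero)

theorem hasCompactSupport_extDeriv {E : Type*} [NormedAddCommGroup E] [NormedSpace ℝ E] {n : ℕ}
    {β : E → E [⋀^Fin n]→L[ℝ] ℝ} (hc : HasCompactSupport β) : HasCompactSupport (extDeriv β) :=
  HasCompactSupport.intro hc fun _ => extDeriv_eq_zero_of_notMem_tsupport

theorem integrable_extDeriv_apply {E : Type*} [NormedAddCommGroup E] [NormedSpace ℝ E]
    [MeasurableSpace E] [BorelSpace E] {μ : Measure E} [IsFiniteMeasureOnCompacts μ] {n : ℕ}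
    {β : E → E [⋀^Fin n]→L[ℝ] ℝ} (hβ : ContDiff ℝ 1 β) (hc : HasCompactSupport β)
    (v : Fin (n + 1) → E) : Integrable (fun x => extDeriv β x v) μ :=
  ((ContinuousAlternatingMap.apply ℝ E ℝ v).continuous.comp
    (continuous_extDeriv hβ)).integrable_of_hasCompactSupport
    ((hasCompactSupport_extDeriv hc).comp_left
      (g := fun b : E [⋀^Fin (n + 1)]→L[ℝ] ℝ => b v) rfl)

theorem extDeriv_sum {ι E G : Type*} [NormedAddCommGroup E] [NormedSpace ℝ E]
    [NormedAddCommGroup G] [NormedSpace ℝ G] {n : ℕ} {s : Finset ι}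
    {β : ι → E → E [⋀^Fin n]→L[ℝ] G} {x : E} (h : ∀ i ∈ s, DifferentiableAt ℝ (β i) x) :
    extDeriv (fun y => ∑ i ∈ s, β i y) x = ∑ i ∈ s, extDeriv (β i) x := by
  rw [extDeriv, fderiv_fun_sum h, ← ContinuousAlternatingMap.alternatizeUncurryFinCLM_apply,
    map_sum]
  rfl

namespace CornerAtlas

variable {U : Set Base} (A : CornerAtlas U)

theorem chart_mem_closure (i : Fin A.n) {z : Base} (hz : z ∈ (A.chart i).source)
    (hzS : z ∈ closure (quadrant (A.S i))) : A.chart i z ∈ closure U :=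
  ((A.chart i).continuousAt hz).continuousWithinAt.mem_closure
    ((A.chart i).open_source.inter_closure ⟨hz, hzS⟩) fun z hz => (A.mem_iff i z hz.1).2 hz.2

theorem boundaryIntegral_congr {α α' : Base → Base [⋀^Fin 2]→L[ℝ] ℝ}
    (h : EqOn α α' (closure U)) : A.boundaryIntegral α = A.boundaryIntegral α' := by
  refine Finset.sum_congr rfl fun i _ => Finset.sum_congr rfl fun j _ => ?_
  congr 1
  refine setIntegral_congr_fun ?_ fun w hw => ?_
  · exact (((A.chart i).open_source.preimage
      (continuous_const.finInsertNth j continuous_id)).inter (isOpen_face _ j)).measurableSet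
  · simp only [pullback, h (A.chart_mem_closure i hw.1 (insertNth_zero_mem_closure_quadrant hw.2))]

theorem sum_face_integral {α : Base → Base [⋀^Fin 2]→L[ℝ] ℝ} (hα : ContDiff ℝ 1 α)
    (hU : IsOpen U) (i : Fin A.n) :
    (∑ j ∈ A.S i, (-1 : ℝ) ^ (j : ℕ) *
      ∫ w in {w : Fin 2 → ℝ | j.insertNth 0 w ∈ (A.chart i).source ∧
          ∀ k ∈ A.S i, k ≠ j → (j.insertNth 0 w : Base) k < 0},
        A.rho i (A.chart i (j.insertNth 0 w)) *
          pullback (A.chart i) α (j.insertNth 0 w) (fun k => Pi.single (j.succAbove k) 1)) =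
      ∫ p in U, extDeriv (fun p => A.rho i p • α p) p (frame 3) := by
  set β : Base → Base [⋀^Fin 2]→L[ℝ] ℝ := fun p => A.rho i p • α p
  have hβ : ContDiff ℝ 1 β := (A.contDiff_rho i).smul hα
  have hc : HasCompactSupport β := (A.hasCompactSupport_rho i).smul_right
  have hs : tsupport β ⊆ (A.chart i).target :=
    (tsupport_smul_subset_left _ _).trans (A.tsupport_rho i)
  rw [← setIntegral_quadrant_extDeriv_chartPullback (A.contDiffOn_chart i) (A.det_pos i)
    hU.measurableSet (A.mem_iff i) hβ hc hs, setIntegral_quadrant_extDeriv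
    (contDiff_chartPullback (A.contDiffOn_chart i) hβ hc hs)
    (hasCompactSupport_chartPullback hc hs)]
  refine Finset.sum_congr rfl fun j _ => ?_
  have hsource : MeasurableSet {w : Fin 2 → ℝ | (j.insertNth 0 w : Base) ∈ (A.chart i).source} :=
    ((A.chart i).open_source.preimage
      (continuous_const.finInsertNth j continuous_id)).measurableSet
  have hindicator (w : Fin 2 → ℝ) :
      chartPullback (A.chart i) β (j.insertNth 0 w) (j.removeNth (frame 3)) =
        {w | (j.insertNth 0 w : Base) ∈ (A.chart i).source}.indicator (fun w =>
          A.rho i (A.chart i (j.insertNth 0 w)) *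
            pullback (A.chart i) α (j.insertNth 0 w) (j.removeNth (frame 3))) w := by
    by_cases hw : (j.insertNth 0 w : Base) ∈ (A.chart i).source
    · rw [chartPullback, indicator_of_mem hw, indicator_of_mem (by exact hw)]
      rfl
    · rw [chartPullback, indicator_of_notMem hw, indicator_of_notMem (by exact hw)]
      rfl
  simp only [hindicator]
  rw [setIntegral_indicator hsource, inter_comm]
  rfl

theorem boundaryIntegral_eq_of_contDiff {α : Base → Base [⋀^Fin 2]→L[ℝ] ℝ}
    (hα : ContDiff ℝ 1 α) (hU : IsOpen U) :
    A.boundaryIntegral α = ∫ p in U, extDeriv α p (frame 3) := by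
  have hsmooth (i : Fin A.n) : ContDiff ℝ 1 fun p => A.rho i p • α p :=
    (A.contDiff_rho i).smul hα
  have hsum {p : Base} (hp : p ∈ U) :
      extDeriv α p = ∑ i, extDeriv (fun p => A.rho i p • α p) p := by
    have hlocal : α =ᶠ[nhds p] fun q => ∑ i, A.rho i q • α q := by
      filter_upwards [hU.mem_nhds hp] with q hq
      rw [← Finset.sum_smul, A.sum_rho q (subset_closure hq), one_smul]
    rw [hlocal.extDeriv_eq, extDeriv_sum fun i _ => (hsmooth i).differentiable one_ne_zero p]
  calc A.boundaryIntegral α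
      = ∑ i, ∫ p in U, extDeriv (fun p => A.rho i p • α p) p (frame 3) :=
        Finset.sum_congr rfl fun i _ => A.sum_face_integral hα hU i
    _ = ∫ p in U, ∑ i, extDeriv (fun p => A.rho i p • α p) p (frame 3) :=
        (integral_finsetSum _ fun i _ => (integrable_extDeriv_apply (hsmooth i)
          (A.hasCompactSupport_rho i).smul_right _).integrableOn).symm
    _ = ∫ p in U, extDeriv α p (frame 3) :=
        setIntegral_congr_fun hU.measurableSet fun p hp => by simp [hsum hp]

theorem boundaryIntegral_eq {X : Set Base} (hX : IsOpen X) (hU : IsOpen U) (hUX : closure U ⊆ X)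
    {α : Base → Base [⋀^Fin 2]→L[ℝ] ℝ} (hα : ContDiffOn ℝ 1 α X) :
    A.boundaryIntegral α = ∫ p in U, extDeriv α p (frame 3) := by
  obtain ⟨χ, hχ, hχX, hχone⟩ := exists_cutoff (m := 1) isClosed_closure hX hUX
  have hχα : ContDiff ℝ 1 fun p => χ p • α p := contDiff_of_tsupport fun p hp =>
    hχ.contDiffAt.smul (hα.contDiffAt (hX.mem_nhds (hχX (tsupport_smul_subset_left χ α hp))))
  have heq : EqOn (fun p => χ p • α p) α (closure U) := fun p hp => by simp [hχone hp]
  rw [← A.boundaryIntegral_congr heq, A.boundaryIntegral_eq_of_contDiff hχα hU]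
  refine setIntegral_congr_fun hU.measurableSet fun p hp => ?_
  have hlocal : (fun p => χ p • α p) =ᶠ[nhds p] α :=
    Filter.eventuallyEq_of_mem (hU.mem_nhds hp) (heq.mono subset_closure)
  simp only [hlocal.extDeriv_eq]

end CornerAtlas

/-! ### Cartan's formula -/

section Cartan

variable {E G : Type*} [NormedAddCommGroup E] [NormedSpace ℝ E]
  [NormedAddCommGroup G] [NormedSpace ℝ G] {n : ℕ}

/-- Contraction with a fixed vector, as a continuous linear map on alternating forms. -/
def contractCLM (n : ℕ) (a : G) : G [⋀^Fin (n + 1)]→L[ℝ] ℝ →L[ℝ] G [⋀^Fin n]→L[ℝ] ℝ :=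
  (ContinuousLinearMap.apply ℝ (G [⋀^Fin n]→L[ℝ] ℝ) a).comp
    ContinuousAlternatingMap.curryLeftLI.toContinuousLinearMap

theorem contractCLM_apply (a : G) (f : G [⋀^Fin (n + 1)]→L[ℝ] ℝ) :
    contractCLM n a f = f.curryLeft a := rfl

theorem removeNth_succ_vecCons {α : Type*} (a : α) (v : Fin (n + 1) → α) (i : Fin (n + 1)) :
    i.succ.removeNth (Matrix.vecCons a v) = Matrix.vecCons a (i.removeNth v) := by
  funext j
  cases j using Fin.cases <;> simp [Fin.removeNth]

/-- Cartan's formula `d (a ⌟ β) = ∂_a β - a ⌟ dβ` for a constant vector field `a`. -/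
theorem extDeriv_contractCLM {β : G → G [⋀^Fin (n + 1)]→L[ℝ] ℝ} {x : G}
    (hβ : DifferentiableAt ℝ β x) (a : G) :
    extDeriv (fun y => contractCLM n a (β y)) x =
      fderiv ℝ β x a - contractCLM (n + 1) a (extDeriv β x) := by
  have hD : fderiv ℝ (fun y => contractCLM n a (β y)) x = (contractCLM n a).comp (fderiv ℝ β x) :=
    ((contractCLM n a).hasFDerivAt.comp x hβ.hasFDerivAt).fderiv
  ext v
  rw [extDeriv, hD]
  simp only [extDeriv, ContinuousAlternatingMap.alternatizeUncurryFin_apply,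
    ContinuousAlternatingMap.sub_apply, contractCLM_apply, ContinuousLinearMap.comp_apply,
    ContinuousAlternatingMap.curryLeft_apply_apply, Fin.sum_univ_succ (n := n + 1),
    removeNth_succ_vecCons, Fin.removeNth_zero]
  simp [pow_succ]

theorem extDeriv_pullback_contractCLM_contractCLM {β : G → G [⋀^Fin (n + 2)]→L[ℝ] ℝ}
    (T : E →L[ℝ] G) {x : E} (hβ : DifferentiableAt ℝ β (T x)) (hclosed : extDeriv β (T x) = 0)
    (hT : ∀ᶠ y in nhds (T x), ∀ a, (contractCLM (n + 1) a (β y)).compContinuousLinearMap T = 0)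
    (a b : G) :
    extDeriv (pullback T fun y => contractCLM n b (contractCLM (n + 1) a (β y))) x = 0 := by
  have hfderiv (v w : G) :
      (contractCLM (n + 1) v (fderiv ℝ β (T x) w)).compContinuousLinearMap T = 0 := by
    let Λ := (ContinuousAlternatingMap.compContinuousLinearMapCLM T).comp (contractCLM (n + 1) v)
    have hΛ : (fun y => Λ (β y)) =ᶠ[nhds (T x)] fun _ => 0 := hT.mono fun y hy => hy v
    have := (Λ.hasFDerivAt.comp (T x) hβ.hasFDerivAt).unique
      ((hasFDerivAt_const 0 _).congr_of_eventuallyEq hΛ)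
    exact congr($this w)
  have hDa : fderiv ℝ (fun y => contractCLM (n + 1) a (β y)) (T x) =
      (contractCLM (n + 1) a).comp (fderiv ℝ β (T x)) :=
    ((contractCLM (n + 1) a).hasFDerivAt.comp _ hβ.hasFDerivAt).fderiv
  have hγ : DifferentiableAt ℝ (fun y => contractCLM (n + 1) a (β y)) (T x) :=
    (contractCLM (n + 1) a).differentiableAt.comp _ hβ
  have hd := extDeriv_contractCLM hγ b
  rw [extDeriv_contractCLM hβ, hclosed, map_zero, sub_zero, hDa] at hd
  have hpull : extDeriv (pullback T fun y => contractCLM n b (contractCLM (n + 1) a (β y))) x =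
      (extDeriv (fun y => contractCLM n b (contractCLM (n + 1) a (β y)))
        (T x)).compContinuousLinearMap (fderiv ℝ T x) :=
    extDeriv_pullback ((contractCLM n b).differentiableAt.comp _ hγ)
      (T.contDiff (n := 2)).contDiffAt (by simp)
  rw [hpull, hd, T.fderiv]
  ext v
  exact congr($(hfderiv a b) v - $(hfderiv b a) v).trans (sub_zero 0)

end Cartan

/-! ### Jets and Taylor polynomials -/

section JetEq

variable {E F G : Type*} [NormedAddCommGroup E] [NormedSpace ℝ E] [NormedAddCommGroup F]
  [NormedSpace ℝ F] [NormedAddCommGroup G] [NormedSpace ℝ G] {n : ℕ}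

/-- `f` and `g` have the same derivatives of order at most `n` at `x`: the coordinate-free form of
equality of `n`-jets. -/
def JetEq (n : ℕ) (f g : E → F) (x : E) : Prop :=
  ∀ k ≤ n, iteratedFDeriv ℝ k f x = iteratedFDeriv ℝ k g x

theorem JetEq.refl (f : E → F) (x : E) : JetEq n f f x := fun _ _ => rfl

theorem JetEq.apply_eq {f g : E → F} {x : E} (h : JetEq n f g x) : f x = g x := by
  simpa using congr($(h 0 n.zero_le) 0)

theorem JetEq.comp {g₁ g₂ : F → G} {f₁ f₂ : E → F} {x : E}
    (hg : JetEq n g₁ g₂ (f₁ x)) (hf : JetEq n f₁ f₂ x)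
    (hg₁ : ContDiffAt ℝ n g₁ (f₁ x)) (hg₂ : ContDiffAt ℝ n g₂ (f₁ x))
    (hf₁ : ContDiffAt ℝ n f₁ x) (hf₂ : ContDiffAt ℝ n f₂ x) :
    JetEq n (g₁ ∘ f₁) (g₂ ∘ f₂) x := by
  intro k hk
  rw [hf.apply_eq] at hg₂
  have hk' : (k : WithTop ℕ∞) ≤ n := by exact_mod_cast hk
  rw [iteratedFDeriv_comp hg₁ hf₁ hk', iteratedFDeriv_comp hg₂ hf₂ hk']
  refine Finset.sum_congr rfl fun c _ => ?_
  have houter := hg _ (c.length_le.trans hk)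
  have hinner : (fun m => iteratedFDeriv ℝ (c.partSize m) f₁ x) =
      fun m => iteratedFDeriv ℝ (c.partSize m) f₂ x :=
    funext fun m => hf _ ((c.partSize_le m).trans hk)
  simp only [FormalMultilinearSeries.compAlongOrderedFinpartition, ftaylorSeries]
  rw [houter, hinner, hf.apply_eq]

theorem JetEq.prodMk {f₁ f₂ : E → F} {g₁ g₂ : E → G} {x : E} (hf : JetEq n f₁ f₂ x)
    (hg : JetEq n g₁ g₂ x) (hf₁ : ContDiffAt ℝ n f₁ x) (hf₂ : ContDiffAt ℝ n f₂ x)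
    (hg₁ : ContDiffAt ℝ n g₁ x) (hg₂ : ContDiffAt ℝ n g₂ x) :
    JetEq n (fun y => (f₁ y, g₁ y)) (fun y => (f₂ y, g₂ y)) x := by
  intro k hk
  have hk' : (k : WithTop ℕ∞) ≤ n := by exact_mod_cast hk
  rw [iteratedFDeriv_prodMk hf₁ hg₁ hk', iteratedFDeriv_prodMk hf₂ hg₂ hk', hf k hk, hg k hk]

theorem JetEq.sum {ι : Type*} (s : Finset ι) {f g : ι → E → F} {x : E}
    (h : ∀ i ∈ s, JetEq n (f i) (g i) x) (hf : ∀ i ∈ s, ContDiffAt ℝ n (f i) x)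
    (hg : ∀ i ∈ s, ContDiffAt ℝ n (g i) x) :
    JetEq n (∑ i ∈ s, f i) (∑ i ∈ s, g i) x := by
  intro k hk
  have hk' : (k : WithTop ℕ∞) ≤ n := by exact_mod_cast hk
  rw [iteratedFDeriv_sum_apply fun i hi => (hf i hi).of_le hk',
    iteratedFDeriv_sum_apply fun i hi => (hg i hi).of_le hk']
  exact Finset.sum_congr rfl fun i hi => h i hi k hk

theorem jetEq_zero_iff {f g : E → F} {x : E} : JetEq 0 f g x ↔ f x = g x := by
  refine ⟨JetEq.apply_eq, fun h k hk => ?_⟩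
  obtain rfl := Nat.le_zero.1 hk
  ext v
  simpa using h

theorem jetEq_succ_iff {f g : E → F} {x : E} :
    JetEq (n + 1) f g x ↔ f x = g x ∧ JetEq n (fderiv ℝ f) (fderiv ℝ g) x := by
  have hsucc (k : ℕ) : iteratedFDeriv ℝ (k + 1) f x = iteratedFDeriv ℝ (k + 1) g x ↔
      iteratedFDeriv ℝ k (fderiv ℝ f) x = iteratedFDeriv ℝ k (fderiv ℝ g) x := by
    simp [iteratedFDeriv_succ_eq_comp_right]
  refine ⟨fun h => ⟨h.apply_eq, fun k hk => (hsucc k).1 (h _ (by lia))⟩, fun h k hk => ?_⟩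
  rcases k with _ | k
  · exact jetEq_zero_iff.2 h.1 0 le_rfl
  · exact (hsucc k).2 (h.2 k (by lia))

end JetEq

section PartialDerivatives

variable {f g : Base → ℝ} {p : Base}

theorem contDiffAt_pd (i : Fin 3) (hf : ContDiffAt ℝ ∞ f p) : ContDiffAt ℝ ∞ (pd i f) p :=
  (hf.fderiv_right (by simp)).clm_apply contDiffAt_const

theorem pd_congr (i : Fin 3) (h : f =ᶠ[nhds p] g) : pd i f =ᶠ[nhds p] pd i g :=
  h.fderiv.mono fun _ hq => congr($hq _)

theorem pd_pd_comm (i j : Fin 3) (hf : ContDiffAt ℝ ∞ f p) :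
    pd i (pd j f) =ᶠ[nhds p] pd j (pd i f) := by
  have hsecond {q : Base} (hq : ContDiffAt ℝ 2 f q) (i j : Fin 3) :
      pd i (pd j f) q = fderiv ℝ (fderiv ℝ f) q (Pi.single i 1) (Pi.single j 1) := by
    have hd : DifferentiableAt ℝ (fderiv ℝ f) q :=
      (hq.fderiv_right (m := 1) (by norm_num)).differentiableAt one_ne_zero
    have hpd : fderiv ℝ (pd j f) q = _ :=
      (hd.hasFDerivAt.clm_apply (hasFDerivAt_const _ _)).fderiv
    simp [pd, hpd]
  filter_upwards [(hf.of_le (m := 2) ENat.LEInfty.out).eventually (by simp)] with q hq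
  rw [hsecond hq, hsecond hq]
  exact hq.isSymmSndFDerivAt (by simp) _ _

theorem contDiffAt_pd_iterate (i : Fin 3) (k : ℕ) (hf : ContDiffAt ℝ ∞ f p) :
    ContDiffAt ℝ ∞ ((pd i)^[k] f) p := by
  induction k generalizing f with
  | zero => exact hf
  | succ _ ih => exact ih (contDiffAt_pd i hf)

theorem pd_iterate_congr (i : Fin 3) (k : ℕ) (h : f =ᶠ[nhds p] g) :
    (pd i)^[k] f =ᶠ[nhds p] (pd i)^[k] g := by
  induction k generalizing f g with
  | zero => exact h
  | succ _ ih => exact ih (pd_congr i h)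

theorem pd_iterate_pd_comm (i j : Fin 3) (k : ℕ) (hf : ContDiffAt ℝ ∞ f p) :
    (pd j)^[k] (pd i f) =ᶠ[nhds p] pd i ((pd j)^[k] f) := by
  induction k generalizing f with
  | zero => rfl
  | succ k ih =>
    exact (pd_iterate_congr j k (pd_pd_comm j i hf)).trans (ih (contDiffAt_pd j hf))

/-- The partial derivative with an arbitrary multi-index, extending `pdJ` beyond order five. -/
def pderiv (m : Fin 3 → ℕ) (f : Base → ℝ) : Base → ℝ :=
  (pd 0)^[m 0] ((pd 1)^[m 1] ((pd 2)^[m 2] f))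

theorem pderiv_congr (m : Fin 3 → ℕ) (h : f =ᶠ[nhds p] g) : pderiv m f =ᶠ[nhds p] pderiv m g :=
  pd_iterate_congr 0 _ (pd_iterate_congr 1 _ (pd_iterate_congr 2 _ h))

theorem pderiv_pd (m : Fin 3 → ℕ) (i : Fin 3) (hf : ContDiffAt ℝ ∞ f p) :
    pderiv m (pd i f) =ᶠ[nhds p] pderiv (m + Pi.single i 1) f := by
  have h2 := contDiffAt_pd_iterate 2 (m 2) hf
  fin_cases i
  · simpa [pderiv] using pd_iterate_congr 0 (m 0)
      ((pd_iterate_congr 1 (m 1) (pd_iterate_pd_comm 0 2 (m 2) hf)).trans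
        (pd_iterate_pd_comm 0 1 (m 1) h2))
  · simpa [pderiv] using pd_iterate_congr 0 (m 0)
      (pd_iterate_congr 1 (m 1) (pd_iterate_pd_comm 1 2 (m 2) hf))
  · simp [pderiv]

theorem fderiv_eq_sum_pd (f : Base → ℝ) :
    fderiv ℝ f = ∑ i, fun q => pd i f q • (ContinuousLinearMap.proj i : Base →L[ℝ] ℝ) := by
  funext q
  ext v
  conv_lhs => rw [pi_eq_sum_univ' v]
  simp [pd, mul_comm]

theorem jetEq_fderiv_iff {n : ℕ} (hf : ContDiffAt ℝ ∞ f p) (hg : ContDiffAt ℝ ∞ g p) :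
    JetEq n (fderiv ℝ f) (fderiv ℝ g) p ↔ ∀ i, JetEq n (pd i f) (pd i g) p := by
  have hn : (n + 1 : WithTop ℕ∞) ≤ ∞ := by exact_mod_cast le_top
  constructor
  · intro h i
    have hL := (ContinuousLinearMap.apply ℝ ℝ (Pi.single i 1 : Base)).contDiff (n := n)
    exact (JetEq.refl _ _).comp h hL.contDiffAt hL.contDiffAt (hf.fderiv_right hn)
      (hg.fderiv_right hn)
  · intro h
    have hL (i : Fin 3) :=
      (ContinuousLinearMap.smulRight (1 : ℝ →L[ℝ] ℝ)
        (ContinuousLinearMap.proj i : Base →L[ℝ] ℝ)).contDiff (n := n)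
    have hpd (i : Fin 3) {f : Base → ℝ} (hf : ContDiffAt ℝ ∞ f p) : ContDiffAt ℝ n (pd i f) p :=
      (contDiffAt_pd i hf).of_le (le_self_add.trans hn)
    rw [fderiv_eq_sum_pd f, fderiv_eq_sum_pd g]
    exact JetEq.sum _
      (fun i _ => (JetEq.refl _ _).comp (h i) (hL i).contDiffAt (hL i).contDiffAt (hpd i hf)
        (hpd i hg))
      (fun i _ => (hL i).contDiffAt.comp p (hpd i hf))
      (fun i _ => (hL i).contDiffAt.comp p (hpd i hg))

theorem jetEq_iff_pderiv {n : ℕ} (hf : ContDiffAt ℝ ∞ f p) (hg : ContDiffAt ℝ ∞ g p) :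
    JetEq n f g p ↔ ∀ m : Fin 3 → ℕ, ∑ i, m i ≤ n → pderiv m f p = pderiv m g p := by
  induction n generalizing f g with
  | zero =>
    rw [jetEq_zero_iff]
    refine ⟨fun h m hm => ?_, fun h => h 0 (by simp)⟩
    obtain rfl : m = 0 := funext fun i =>
      Nat.le_zero.1 ((Finset.single_le_sum_of_canonicallyOrdered (Finset.mem_univ i)).trans hm)
    exact h
  | succ n ih =>
    rw [jetEq_succ_iff, jetEq_fderiv_iff hf hg]
    simp only [ih (contDiffAt_pd _ hf) (contDiffAt_pd _ hg), (pderiv_pd _ _ hf).eq_of_nhds,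
      (pderiv_pd _ _ hg).eq_of_nhds]
    refine ⟨fun h m hm => ?_, fun h => ⟨h 0 (by simp), fun i m hm => h _ ?_⟩⟩
    · by_cases hm0 : m = 0
      · exact hm0 ▸ h.1
      obtain ⟨i, hi⟩ := Function.ne_iff.1 hm0
      have hsub : m - Pi.single i 1 + Pi.single i 1 = m :=
        tsub_add_cancel_of_le (update_le_iff.2 ⟨Nat.one_le_iff_ne_zero.2 hi, by simp⟩)
      rw [← hsub] at hm ⊢
      refine h.2 i _ ?_
      simpa [Finset.sum_add_distrib] using hm
    · simpa [Finset.sum_add_distrib] using hm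

end PartialDerivatives

section Taylor

variable {ι : Type*} [Fintype ι] {c : ι → ℝ} {h : ι → Fin 3 → ℝ → ℝ}

theorem pd_sum_prod (hh : ∀ K j, Differentiable ℝ (h K j)) (i : Fin 3) :
    pd i (fun q => ∑ K, c K * ∏ j, h K j (q j)) =
      fun q => ∑ K, c K * ∏ j, Function.update (h K) i (deriv (h K i)) j (q j) := by
  funext q
  have hfactor (K : ι) (j : Fin 3) : HasFDerivAt (fun q : Base => h K j (q j))
      (deriv (h K j) (q j) • (ContinuousLinearMap.proj j : Base →L[ℝ] ℝ)) q :=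
    (hh K j (q j)).hasDerivAt.comp_hasFDerivAt q (hasFDerivAt_apply j q)
  have hsum := HasFDerivAt.fun_sum (u := Finset.univ) fun K _ =>
    (HasFDerivAt.finsetProd (u := Finset.univ) fun j _ => hfactor K j).const_mul (c K)
  rw [pd, hsum.fderiv]
  simp only [_root_.sum_apply, _root_.smul_apply,
    ContinuousLinearMap.proj_apply, smul_eq_mul]
  refine Finset.sum_congr rfl fun K _ => congrArg (c K * ·) ?_
  rw [Finset.sum_eq_single i (fun j _ hj => by simp [hj]) (by simp),
    ← Finset.mul_prod_erase _ _ (Finset.mem_univ i), Function.update_self, Pi.single_eq_same,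
    mul_one, mul_comm]
  congr 1
  exact Finset.prod_congr rfl fun j hj => by rw [Function.update_of_ne (Finset.ne_of_mem_erase hj)]

theorem contDiff_update_iteratedDeriv {g : Fin 3 → ℝ → ℝ} (hg : ∀ j, ContDiff ℝ ∞ (g j))
    (i : Fin 3) (k : ℕ) (j : Fin 3) :
    ContDiff ℝ ∞ (Function.update g i (iteratedDeriv k (g i)) j) := by
  rcases eq_or_ne j i with rfl | hj
  · simpa [iteratedDeriv_eq_iterate] using (hg j).iterate_deriv k
  · simpa [hj] using hg j

theorem pd_iterate_sum_prod (hh : ∀ K j, ContDiff ℝ ∞ (h K j)) (i : Fin 3) (k : ℕ) :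
    (pd i)^[k] (fun q => ∑ K, c K * ∏ j, h K j (q j)) =
      fun q => ∑ K, c K * ∏ j, Function.update (h K) i (iteratedDeriv k (h K i)) j (q j) := by
  induction k generalizing h with
  | zero => simp
  | succ k ih =>
    rw [Function.iterate_succ_apply, pd_sum_prod fun K j => (hh K j).differentiable (by simp),
      ih fun K j => by simpa using contDiff_update_iteratedDeriv (hh K) i 1 j]
    simp [iteratedDeriv_succ']

theorem pderiv_sum_prod (hh : ∀ K j, ContDiff ℝ ∞ (h K j)) (m : Fin 3 → ℕ) :
    pderiv m (fun q => ∑ K, c K * ∏ j, h K j (q j)) =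
      fun q => ∑ K, c K * ∏ j, iteratedDeriv (m j) (h K j) (q j) := by
  have h2 (K : ι) := contDiff_update_iteratedDeriv (hh K) 2 (m 2)
  have h1 (K : ι) := contDiff_update_iteratedDeriv (h2 K) 1 (m 1)
  rw [pderiv, pd_iterate_sum_prod hh, pd_iterate_sum_prod h2, pd_iterate_sum_prod h1]
  simp [Fin.prod_univ_three]

theorem iteratedDeriv_sub_pow_div_factorial (k l : ℕ) (a : ℝ) :
    iteratedDeriv l (fun x => (x - a) ^ k / (k.factorial : ℝ)) a = if k = l then 1 else 0 := by
  have hpow : iteratedDeriv l (fun x => (x - a) ^ k) a = if l = k then k.factorial else 0 := by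
    rw [iteratedDeriv_comp_sub_const l (fun x : ℝ => x ^ k) a]
    beta_reduce
    rw [sub_self, iteratedDeriv_fun_pow_zero]
  rw [iteratedDeriv_div_const, hpow]
  rcases eq_or_ne k l with rfl | hkl
  · simp [Nat.factorial_ne_zero]
  · simp [hkl, hkl.symm]

theorem pdJ_taylor (J : Idx) (z : J5) : pdJ J (taylor z) z.1 = z.2 J := by
  have hsmooth (K : Idx) (j : Fin 3) : ContDiff ℝ ∞
      fun x : ℝ => (x - z.1 j) ^ (K.1 j : ℕ) / (Nat.factorial (K.1 j) : ℝ) := by fun_prop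
  have hprod (K : Idx) : (∏ j, if (K.1 j : ℕ) = J.1 j then (1 : ℝ) else 0) =
      if K = J then 1 else 0 := by
    simp [Finset.prod_ite_zero, Fin.val_inj, Subtype.ext_iff, funext_iff]
  refine (congrFun (pderiv_sum_prod (c := z.2) hsmooth fun i => J.1 i) z.1).trans ?_
  simp only [iteratedDeriv_sub_pow_div_factorial, hprod, mul_ite, mul_one, mul_zero,
    Finset.sum_ite_eq', Finset.mem_univ, if_true]

theorem contDiff_taylor : ContDiff ℝ ∞ fun x : J5 × Base => taylor x.1 x.2 := by
  unfold taylor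
  fun_prop

end Taylor

theorem contDiffAt_of_uncurry {D E F : Type*} [NormedAddCommGroup D] [NormedSpace ℝ D]
    [NormedAddCommGroup E] [NormedSpace ℝ E] [NormedAddCommGroup F] [NormedSpace ℝ F]
    {n : WithTop ℕ∞} {ψ : D → E → F} {q : D → E} {x : D}
    (hψ : ContDiffAt ℝ n (Function.uncurry ψ) (x, q x)) (hq : ContDiffAt ℝ n q x) :
    ContDiffAt ℝ n (fun y => ψ y (q y)) x :=
  ContDiffAt.comp (f := fun y => (y, q y)) x hψ (contDiffAt_id.prodMk hq)

section Jets

variable {D : Type*} [NormedAddCommGroup D] [NormedSpace ℝ D] {ψ : D → Base → ℝ} {x : D}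
  {f g : Base → ℝ} {p : Base}

theorem contDiffAt_pd_param (i : Fin 3)
    (hψ : ContDiffAt ℝ ∞ (Function.uncurry ψ) (x, p)) :
    ContDiffAt ℝ ∞ (Function.uncurry fun y => pd i (ψ y)) (x, p) := by
  have hfderiv : ContDiffAt ℝ ∞ (fun y : D × Base => fderiv ℝ (ψ y.1) y.2) (x, p) :=
    ContDiffAt.fderiv (n := ∞) (f := fun y : D × Base => ψ y.1) (g := Prod.snd)
      (hψ.comp (((x, p), p) : (D × Base) × Base)
        (contDiffAt_fst.fst.prodMk contDiffAt_snd)) contDiffAt_snd (by simp)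
  exact hfderiv.clm_apply contDiffAt_const

theorem contDiffAt_pd_iterate_param (i : Fin 3) (k : ℕ)
    (hψ : ContDiffAt ℝ ∞ (Function.uncurry ψ) (x, p)) :
    ContDiffAt ℝ ∞ (Function.uncurry fun y => (pd i)^[k] (ψ y)) (x, p) := by
  induction k generalizing ψ with
  | zero => exact hψ
  | succ _ ih => exact ih (contDiffAt_pd_param i hψ)

theorem contDiffAt_jet (hψ : ContDiffAt ℝ ∞ (Function.uncurry ψ) (x, p)) :
    ContDiffAt ℝ ∞ (Function.uncurry fun y => jet (ψ y)) (x, p) :=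
  contDiffAt_snd.prodMk (contDiffAt_pi.2 fun _ =>
    contDiffAt_pd_iterate_param 0 _
      (contDiffAt_pd_iterate_param 1 _ (contDiffAt_pd_iterate_param 2 _ hψ)))

theorem jet_congr (h : f =ᶠ[nhds p] g) : jet f p = jet g p :=
  Prod.ext rfl (funext fun J => (pderiv_congr (fun i => J.1 i) h).eq_of_nhds)

theorem jet_eq_jet_iff (hf : ContDiffAt ℝ ∞ f p) (hg : ContDiffAt ℝ ∞ g p) :
    jet f p = jet g p ↔ JetEq 5 f g p := by
  rw [jetEq_iff_pderiv hf hg]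
  refine ⟨fun h m hm => ?_, fun h => Prod.ext rfl (funext fun J => h _ J.2)⟩
  have hlt (i : Fin 3) : m i < 6 := Nat.lt_succ_of_le
    ((Finset.single_le_sum_of_canonicallyOrdered (Finset.mem_univ i)).trans hm)
  exact congr($(h).2 ⟨fun i => ⟨m i, hlt i⟩, hm⟩)

theorem jet_taylor_self (z : J5) : jet (taylor z) z.1 = z :=
  Prod.ext rfl (funext fun J => pdJ_taylor J z)

end Jets

namespace OneParamGroup

variable {X : Set Base} {D : Type*} [NormedAddCommGroup D] [NormedSpace ℝ D] {s : D → ℝ}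
  {q : D → Base} {x : D} {p : Base} {ψ : Base → ℝ}

theorem contDiffAt_base (η : OneParamGroup X) (hX : IsOpen X) (hs : ContDiffAt ℝ ∞ s x)
    (hq : ContDiffAt ℝ ∞ q x) (hx : q x ∈ X) :
    ContDiffAt ℝ ∞ (fun y => η.base (s y) (q y)) x :=
  (η.contDiffOn_base.contDiffAt ((isOpen_univ.prod hX).mem_nhds ⟨mem_univ (s x), hx⟩)).comp x
    (hs.prodMk hq)

theorem contDiffAt_fib (η : OneParamGroup X) (hX : IsOpen X) {u : D → ℝ}
    (hs : ContDiffAt ℝ ∞ s x) (hq : ContDiffAt ℝ ∞ q x) (hu : ContDiffAt ℝ ∞ u x)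
    (hx : q x ∈ X) : ContDiffAt ℝ ∞ (fun y => η.fib (s y) (q y) (u y)) x :=
  (η.contDiffOn_fib.contDiffAt ((isOpen_univ.prod (hX.prod isOpen_univ)).mem_nhds
    ⟨mem_univ (s x), hx, mem_univ (u x)⟩)).comp x (hs.prodMk (hq.prodMk hu))

theorem base_neg_base (η : OneParamGroup X) (s : ℝ) (hp : p ∈ X) :
    η.base (-s) (η.base s p) = p := by
  rw [← η.base_add _ _ p hp, neg_add_cancel, η.base_zero p hp]

theorem contDiffAt_act (η : OneParamGroup X) (hX : IsOpen X) {ψ : D → Base → ℝ}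
    (hs : ContDiffAt ℝ ∞ s x) (hp : p ∈ X) (hψ : ContDiffAt ℝ ∞ (Function.uncurry ψ) (x, p)) :
    ContDiffAt ℝ ∞ (Function.uncurry fun y => η.act (s y) (ψ y)) (x, η.base (s x) p) := by
  have hs' : ContDiffAt ℝ ∞ (fun y : D × Base => s y.1) (x, η.base (s x) p) :=
    hs.comp _ contDiffAt_fst
  have hb := η.contDiffAt_base hX hs'.neg contDiffAt_snd (η.mapsTo (s x) hp)
  rw [← η.base_neg_base (s x) hp] at hψ
  exact η.contDiffAt_fib hX hs' hb
    (ContDiffAt.comp (g := Function.uncurry ψ)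
      (f := fun y : D × Base => (y.1, η.base (-s y.1) y.2)) _ hψ (contDiffAt_fst.prodMk hb))
    (η.mapsTo _ (η.mapsTo _ hp))

theorem contDiffAt_act_section (η : OneParamGroup X) (hX : IsOpen X) (s : ℝ) (hp : p ∈ X)
    (hψ : ContDiffAt ℝ ∞ ψ p) : ContDiffAt ℝ ∞ (η.act s ψ) (η.base s p) :=
  contDiffAt_of_uncurry (η.contDiffAt_act hX (s := fun _ : Base => s) contDiffAt_const hp
    (ContDiffAt.comp (g := ψ) _ hψ contDiffAt_snd)) contDiffAt_id

theorem jetEq_act (η : OneParamGroup X) (hX : IsOpen X) (s : ℝ) (hp : p ∈ X) {f g : Base → ℝ}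
    {n : ℕ} (h : JetEq n f g p) (hf : ContDiffAt ℝ ∞ f p) (hg : ContDiffAt ℝ ∞ g p) :
    JetEq n (η.act s f) (η.act s g) (η.base s p) := by
  have hn : (n : WithTop ℕ∞) ≤ ∞ := ENat.LEInfty.out
  have hback := η.base_neg_base s hp
  have hb : ContDiffAt ℝ n (η.base (-s)) (η.base s p) :=
    (η.contDiffAt_base hX contDiffAt_const contDiffAt_id (η.mapsTo s hp)).of_le hn
  have hfib : ContDiffAt ℝ n (fun y : Base × ℝ => η.fib s y.1 y.2) (p, f p) :=
    (η.contDiffAt_fib hX contDiffAt_const contDiffAt_fst contDiffAt_snd hp).of_le hn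
  replace hf := hf.of_le hn
  replace hg := hg.of_le hn
  rw [← hback] at h hf hg hfib
  exact (JetEq.refl (fun y : Base × ℝ => η.fib s y.1 y.2) _).comp
    ((JetEq.refl _ _).prodMk (h.comp (JetEq.refl _ _) hf hg hb hb) hb hb
      (hf.comp _ hb) (hg.comp _ hb)) hfib hfib (hb.prodMk (hf.comp _ hb)) (hb.prodMk (hg.comp _ hb))

/-- The polynomial representative in `prolong` may be replaced by any section with the same jet. -/
theorem prolong_jet (η : OneParamGroup X) (hX : IsOpen X) (s : ℝ) (hp : p ∈ X)
    (hψ : ContDiffAt ℝ ∞ ψ p) :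
    η.prolong s (jet ψ p) = jet (η.act s ψ) (η.base s p) := by
  have htaylor : ContDiffAt ℝ ∞ (taylor (jet ψ p)) p :=
    (contDiff_taylor.comp (contDiff_prodMk_right _)).contDiffAt
  have hjet : JetEq 5 (taylor (jet ψ p)) ψ p :=
    (jet_eq_jet_iff htaylor hψ).1 (jet_taylor_self (jet ψ p))
  exact (jet_eq_jet_iff (η.contDiffAt_act_section hX s hp htaylor)
    (η.contDiffAt_act_section hX s hp hψ)).2 (η.jetEq_act hX s hp hjet htaylor hψ)

theorem act_zero_eqOn (η : OneParamGroup X) (ψ : Base → ℝ) : EqOn (η.act 0 ψ) ψ X :=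
  fun p hp => by simp only [act, neg_zero, η.base_zero p hp, η.fib_zero p hp]

theorem prolong_zero_jet (η : OneParamGroup X) (hX : IsOpen X) (hp : p ∈ X)
    (hψ : ContDiffAt ℝ ∞ ψ p) : η.prolong 0 (jet ψ p) = jet ψ p := by
  rw [η.prolong_jet hX 0 hp hψ, η.base_zero p hp]
  exact jet_congr ((η.act_zero_eqOn ψ).eventuallyEq_of_mem (hX.mem_nhds hp))

end OneParamGroup

/-! ### The two-parameter family of solutions -/

section Multisymplectic

variable {n : ℕ} {X : Set Base}

/-- `φ` is a smooth section over `X` with `j⁵(φ)^* (W ⌟ Ω) = 0` for all smooth vector fields `W` on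
the jets over `X`: the Euler–Lagrange equation of `IsSolution` for an arbitrary form `Ω` in place
of `Omega σ`. -/
def IsExtremal (Ω : J5 → J5 [⋀^Fin (n + 1)]→L[ℝ] ℝ) (X : Set Base) (φ : Base → ℝ) : Prop :=
  ContDiffOn ℝ ∞ φ X ∧
    ∀ W : J5 → J5, ContDiffOn ℝ ∞ W {z | z.1 ∈ X} →
      ∀ p ∈ X, pullback (jet φ) (contract W Ω) p = 0

variable {Ω : J5 → J5 [⋀^Fin (n + 1)]→L[ℝ] ℝ} {φ ψ : Base → ℝ} {p : Base}

theorem IsExtremal.contDiffAt_jet (hφ : IsExtremal Ω X φ) (hX : IsOpen X) (hp : p ∈ X) :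
    ContDiffAt ℝ ∞ (jet φ) p :=
  contDiffAt_of_uncurry (q := id) (KP.contDiffAt_jet (ψ := fun _ : Base => φ) (x := p)
    (ContDiffAt.comp (g := φ) (p, p) (hφ.1.contDiffAt (hX.mem_nhds hp)) contDiffAt_snd))
    contDiffAt_id

theorem contractCLM_pullback_comp_inr {P : Type*} [NormedAddCommGroup P] [NormedSpace ℝ P]
    (hX : IsOpen X) (hψ : IsExtremal Ω X ψ) {F : P × Base → J5} {b : Base → Base} {l : P}
    (hF : DifferentiableAt ℝ F (l, p)) (hb : DifferentiableAt ℝ b p) (hbp : b p ∈ X)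
    (hFb : (fun q => F (l, q)) =ᶠ[nhds p] fun q => jet ψ (b q)) (w : P × Base) :
    (contractCLM n w (pullback F Ω (l, p))).compContinuousLinearMap
      (ContinuousLinearMap.inr ℝ P Base) = 0 := by
  have hjet : DifferentiableAt ℝ (jet ψ) (b p) :=
    (hψ.contDiffAt_jet hX hbp).differentiableAt (by simp)
  have hchain : (fderiv ℝ F (l, p)).comp (ContinuousLinearMap.inr ℝ P Base) =
      (fderiv ℝ (jet ψ) (b p)).comp (fderiv ℝ b p) := by
    have hfib : HasFDerivAt (fun q => F (l, q)) _ p :=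
      hF.hasFDerivAt.comp p (hasFDerivAt_prodMk_right l p)
    exact hfib.unique ((hjet.hasFDerivAt.comp p hb.hasFDerivAt).congr_of_eventuallyEq hFb)
  have hextremal := hψ.2 (fun _ => fderiv ℝ F (l, p) w) contDiffOn_const (b p) hbp
  have hFp : F (l, p) = jet ψ (b p) := hFb.eq_of_nhds
  rw [contractCLM_apply, pullback,
    ContinuousAlternatingMap.curryLeft_compContinuousLinearMap, hFp]
  change ((Ω (jet ψ (b p))).curryLeft (fderiv ℝ F (l, p) w)).compContinuousLinearMap
    ((fderiv ℝ F (l, p)).comp (ContinuousLinearMap.inr ℝ P Base)) = 0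
  rw [hchain]
  exact congrArg (·.compContinuousLinearMap (fderiv ℝ b p)) hextremal

end Multisymplectic

namespace OneParamGroup

variable {X : Set Base} {φ : Base → ℝ} {p : Base}

/-- The two-parameter family of jets `j⁵(η_Y^r) j⁵(ξ_Y^s) j⁵(φ)(p)`, as a function of
`((r, s), p)`. -/
def jetFamily (η ξ : OneParamGroup X) (φ : Base → ℝ) (x : (ℝ × ℝ) × Base) : J5 :=
  η.prolong x.1.1 (ξ.prolong x.1.2 (jet φ x.2))

variable (η ξ : OneParamGroup X)

theorem jetFamily_eq (hX : IsOpen X) (hφ : ContDiffOn ℝ ∞ φ X) (r s : ℝ) (hp : p ∈ X) :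
    η.jetFamily ξ φ ((r, s), p) =
      jet (η.act r (ξ.act s φ)) (η.base r (ξ.base s p)) := by
  have hφp := hφ.contDiffAt (hX.mem_nhds hp)
  rw [jetFamily, ξ.prolong_jet hX s hp hφp,
    η.prolong_jet hX r (ξ.mapsTo s hp) (ξ.contDiffAt_act_section hX s hp hφp)]

theorem contDiffAt_jetFamily (hX : IsOpen X) (hφ : ContDiffOn ℝ ∞ φ X) (l : ℝ × ℝ)
    (hp : p ∈ X) : ContDiffAt ℝ ∞ (η.jetFamily ξ φ) (l, p) := by
  have hsection : ContDiffAt ℝ ∞ (Function.uncurry fun k : ℝ × ℝ => η.act k.1 (ξ.act k.2 φ))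
      (l, η.base l.1 (ξ.base l.2 p)) :=
    η.contDiffAt_act hX contDiffAt_fst (ξ.mapsTo l.2 hp) (ξ.contDiffAt_act hX contDiffAt_snd hp
      (ContDiffAt.comp (g := φ) _ (hφ.contDiffAt (hX.mem_nhds hp)) contDiffAt_snd))
  have hbase : ContDiffAt ℝ ∞ (fun y : (ℝ × ℝ) × Base => η.base y.1.1 (ξ.base y.1.2 y.2)) (l, p) :=
    η.contDiffAt_base hX contDiffAt_fst.fst
      (ξ.contDiffAt_base hX contDiffAt_fst.snd contDiffAt_snd hp) (ξ.mapsTo l.2 hp)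
  have heq : η.jetFamily ξ φ =ᶠ[nhds (l, p)] fun y => jet (η.act y.1.1 (ξ.act y.1.2 φ))
      (η.base y.1.1 (ξ.base y.1.2 y.2)) := by
    filter_upwards [(isOpen_univ.prod hX).mem_nhds ⟨mem_univ l, hp⟩] with y hy
    exact η.jetFamily_eq ξ hX hφ _ _ hy.2
  exact (ContDiffAt.comp
    (g := Function.uncurry fun k : ℝ × ℝ => jet (η.act k.1 (ξ.act k.2 φ)))
    (f := fun y : (ℝ × ℝ) × Base => (y.1, η.base y.1.1 (ξ.base y.1.2 y.2))) _
    (contDiffAt_jet hsection) (contDiffAt_fst.prodMk hbase)).congr_of_eventuallyEq heq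

theorem jetFamily_zero (hX : IsOpen X) (hφ : ContDiffOn ℝ ∞ φ X) (hp : p ∈ X) :
    η.jetFamily ξ φ (0, p) = jet φ p := by
  have hφp := hφ.contDiffAt (hX.mem_nhds hp)
  change η.prolong 0 (ξ.prolong 0 (jet φ p)) = jet φ p
  rw [ξ.prolong_zero_jet hX hp hφp, η.prolong_zero_jet hX hp hφp]

theorem fderiv_jetFamily_left (hX : IsOpen X) (hφ : ContDiffOn ℝ ∞ φ X) (hp : p ∈ X) :
    fderiv ℝ (η.jetFamily ξ φ) (0, p) ((1, 0), 0) = η.jetGenerator (jet φ p) := by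
  have hF := (η.contDiffAt_jetFamily ξ hX hφ 0 hp).differentiableAt (by simp)
  rw [← hF.lineDeriv_eq_fderiv, lineDeriv, jetGenerator]
  congr 1
  funext r
  simp [jetFamily, ξ.prolong_zero_jet hX hp (hφ.contDiffAt (hX.mem_nhds hp))]

theorem fderiv_jetFamily_right (hX : IsOpen X) (hφ : ContDiffOn ℝ ∞ φ X) (hp : p ∈ X) :
    fderiv ℝ (η.jetFamily ξ φ) (0, p) ((0, 1), 0) = ξ.jetGenerator (jet φ p) := by
  have hφp := hφ.contDiffAt (hX.mem_nhds hp)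
  have hF := (η.contDiffAt_jetFamily ξ hX hφ 0 hp).differentiableAt (by simp)
  rw [← hF.lineDeriv_eq_fderiv, lineDeriv, jetGenerator]
  congr 1
  funext s
  simp [jetFamily, ξ.prolong_jet hX s hp hφp,
    η.prolong_zero_jet hX (ξ.mapsTo s hp) (ξ.contDiffAt_act_section hX s hp hφp)]

theorem fderiv_jetFamily_comp_inr (hX : IsOpen X) (hφ : ContDiffOn ℝ ∞ φ X) (hp : p ∈ X) :
    (fderiv ℝ (η.jetFamily ξ φ) (0, p)).comp (ContinuousLinearMap.inr ℝ (ℝ × ℝ) Base) =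
      fderiv ℝ (jet φ) p := by
  have hF := (η.contDiffAt_jetFamily ξ hX hφ 0 hp).differentiableAt (by simp)
  have hjet : jet φ =ᶠ[nhds p] fun q => η.jetFamily ξ φ (0, q) := by
    filter_upwards [hX.mem_nhds hp] with q hq using (η.jetFamily_zero ξ hX hφ hq).symm
  rw [hjet.fderiv_eq]
  exact (hF.hasFDerivAt.comp p (hasFDerivAt_prodMk_right 0 p)).fderiv.symm

variable {n : ℕ} {Ω : J5 → J5 [⋀^Fin (n + 2)]→L[ℝ] ℝ}

theorem contractCLM_pullback_jetFamily_comp_inr (hX : IsOpen X) (hφ : ContDiffOn ℝ ∞ φ X)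
    (hext : ∀ r s, IsExtremal Ω X (η.act r (ξ.act s φ)))
    (l : ℝ × ℝ) (hp : p ∈ X) (w : (ℝ × ℝ) × Base) :
    (contractCLM (n + 1) w (pullback (η.jetFamily ξ φ) Ω (l, p))).compContinuousLinearMap
      (ContinuousLinearMap.inr ℝ (ℝ × ℝ) Base) = 0 := by
  have hbase : ContDiffAt ℝ ∞ (fun q => η.base l.1 (ξ.base l.2 q)) p :=
    η.contDiffAt_base hX contDiffAt_const
      (ξ.contDiffAt_base hX contDiffAt_const contDiffAt_id hp) (ξ.mapsTo l.2 hp)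
  have hfamily : (fun q => η.jetFamily ξ φ (l, q)) =ᶠ[nhds p]
      fun q => jet (η.act l.1 (ξ.act l.2 φ)) (η.base l.1 (ξ.base l.2 q)) := by
    filter_upwards [hX.mem_nhds hp] with q hq using η.jetFamily_eq ξ hX hφ _ _ hq
  exact contractCLM_pullback_comp_inr hX (hext l.1 l.2)
    ((η.contDiffAt_jetFamily ξ hX hφ l hp).differentiableAt (by simp))
    (hbase.differentiableAt (by simp)) (η.mapsTo l.1 (ξ.mapsTo l.2 hp)) hfamily w

theorem pullback_jet_contract_contract (hX : IsOpen X) (hφ : ContDiffOn ℝ ∞ φ X) (hp : p ∈ X) :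
    pullback (jet φ) (contract η.jetGenerator (contract ξ.jetGenerator Ω)) p =
      pullback (ContinuousLinearMap.inr ℝ (ℝ × ℝ) Base) (fun y => contractCLM n ((1, 0), 0)
        (contractCLM (n + 1) ((0, 1), 0) (pullback (η.jetFamily ξ φ) Ω y))) p := by
  simp only [pullback, contract, contractCLM_apply, ContinuousLinearMap.fderiv,
    ContinuousLinearMap.inr_apply, ContinuousAlternatingMap.curryLeft_compContinuousLinearMap,
    η.jetFamily_zero ξ hX hφ hp, η.fderiv_jetFamily_left ξ hX hφ hp,
    η.fderiv_jetFamily_right ξ hX hφ hp, ← η.fderiv_jetFamily_comp_inr ξ hX hφ hp]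
  rfl

theorem contDiffAt_pullback_jetFamily (hX : IsOpen X) (hΩ : ContDiffOn ℝ 1 Ω {z | z.1 ∈ X})
    (hφ : ContDiffOn ℝ ∞ φ X) (hp : p ∈ X) :
    ContDiffAt ℝ 1 (pullback (η.jetFamily ξ φ) Ω) (0, p) := by
  have hΩp : ContDiffAt ℝ 1 Ω (η.jetFamily ξ φ (0, p)) := by
    rw [η.jetFamily_zero ξ hX hφ hp]
    exact hΩ.contDiffAt ((hX.preimage continuous_fst).mem_nhds hp)
  exact contDiffAt_pullback ((η.contDiffAt_jetFamily ξ hX hφ 0 hp).of_le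
    (one_add_one_eq_two.trans_le ENat.LEInfty.out)) hΩp

theorem contDiffOn_pullback_jet_contract_contract (hX : IsOpen X)
    (hΩ : ContDiffOn ℝ 1 Ω {z | z.1 ∈ X}) (hφ : ContDiffOn ℝ ∞ φ X) :
    ContDiffOn ℝ 1
      (pullback (jet φ) (contract η.jetGenerator (contract ξ.jetGenerator Ω))) X := by
  refine ContDiffOn.congr (fun p hp => ?_) fun p hp =>
    η.pullback_jet_contract_contract ξ hX hφ hp
  have hγ := (contractCLM n ((1, 0), 0)).contDiff.contDiffAt.comp _
    ((contractCLM (n + 1) ((0, 1), 0)).contDiff.contDiffAt.comp _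
      (η.contDiffAt_pullback_jetFamily ξ hX hΩ hφ hp))
  exact (contDiffAt_pullback (ContinuousLinearMap.inr ℝ (ℝ × ℝ) Base).contDiff.contDiffAt
    hγ).contDiffWithinAt

theorem extDeriv_pullback_jet_contract_contract (hX : IsOpen X)
    (hΩ : ContDiffOn ℝ 1 Ω {z | z.1 ∈ X}) (hclosed : ∀ z, z.1 ∈ X → extDeriv Ω z = 0)
    (hφ : ContDiffOn ℝ ∞ φ X) (hext : ∀ r s, IsExtremal Ω X (η.act r (ξ.act s φ)))
    (hp : p ∈ X) :
    extDeriv (pullback (jet φ) (contract η.jetGenerator (contract ξ.jetGenerator Ω))) p = 0 := by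
  have hlocal := Filter.eventuallyEq_of_mem (hX.mem_nhds hp) fun q hq =>
    η.pullback_jet_contract_contract ξ (Ω := Ω) hX hφ hq
  rw [hlocal.extDeriv_eq]
  have hjet := η.jetFamily_zero ξ hX hφ hp
  have hΩp : DifferentiableAt ℝ Ω (η.jetFamily ξ φ (0, p)) := by
    rw [hjet]
    exact (hΩ.contDiffAt ((hX.preimage continuous_fst).mem_nhds hp)).differentiableAt one_ne_zero
  have hpull : extDeriv (pullback (η.jetFamily ξ φ) Ω) (0, p) = 0 := by
    have h : extDeriv (pullback (η.jetFamily ξ φ) Ω) (0, p) = _ :=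
      extDeriv_pullback hΩp (η.contDiffAt_jetFamily ξ hX hφ 0 hp)
        (by simpa using ENat.LEInfty.out)
    rw [h, hjet, hclosed _ hp]
    rfl
  refine extDeriv_pullback_contractCLM_contractCLM _
    ((η.contDiffAt_pullback_jetFamily ξ hX hΩ hφ hp).differentiableAt one_ne_zero) hpull ?_ _ _
  filter_upwards [(isOpen_univ.prod hX).mem_nhds ⟨mem_univ _, hp⟩] with y hy w
  exact η.contractCLM_pullback_jetFamily_comp_inr ξ hX hφ hext y.1 hy.2 w

end OneParamGroup

theorem contDiff_theta (σ : ℝ) : ContDiff ℝ ∞ (theta σ) := by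
  unfold theta
  fun_prop

theorem contDiff_Omega (σ : ℝ) : ContDiff ℝ ∞ (Omega σ) :=
  ((ContinuousAlternatingMap.alternatizeUncurryFinCLM ℝ J5 ℝ).contDiff.comp
    ((contDiff_theta σ).fderiv_right (by simp))).neg

theorem extDeriv_Omega (σ : ℝ) (z : J5) : extDeriv (Omega σ) z = 0 := by
  have hneg : Omega σ = (-1 : ℝ) • extDeriv (theta σ) := funext fun z => (neg_one_smul ℝ _).symm
  have hdd : extDeriv (extDeriv (theta σ)) z = 0 :=
    extDeriv_extDeriv_apply (contDiff_theta σ).contDiffAt (by simpa using ENat.LEInfty.out)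
  rw [hneg, extDeriv_smul, hdd, smul_zero]

end KP

end

theorem theorem2p3_general {X : Set KP.Base} (hX : IsOpen X)
    {Ω : KP.J5 → KP.J5 [⋀^Fin 4]→L[ℝ] ℝ} (hΩ : ContDiffOn ℝ 1 Ω {z | z.1 ∈ X})
    (hclosed : ∀ z, z.1 ∈ X → extDeriv Ω z = 0) (η ξ : KP.OneParamGroup X)
    {φ : KP.Base → ℝ} (hext : ∀ r s, KP.IsExtremal Ω X (η.act r (ξ.act s φ)))
    {U : Set KP.Base} (hU : IsOpen U) (hUX : closure U ⊆ X) (A : KP.CornerAtlas U) :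
    A.boundaryIntegral
      (KP.pullback (KP.jet φ)
        (KP.contract η.jetGenerator (KP.contract ξ.jetGenerator Ω))) = 0 := by
  have hφ : ContDiffOn ℝ ∞ φ X := (hext 0 0).1.congr fun p hp =>
    ((η.act_zero_eqOn _ hp).trans (ξ.act_zero_eqOn φ hp)).symm
  rw [A.boundaryIntegral_eq hX hU hUX
    (η.contDiffOn_pullback_jet_contract_contract ξ hX hΩ hφ)]
  exact setIntegral_eq_zero_of_forall_eq_zero fun p hp =>
    congr($(η.extDeriv_pullback_jet_contract_contract ξ hX hΩ hclosed hφ hext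
      (hUX (subset_closure hp))) (KP.frame 3))

theorem theorem2p3 (σ : ℝ) (X : Set KP.Base) (hX : IsOpen X)
    (η ξ : KP.OneParamGroup X) (hη : η.IsSymmetry σ) (hξ : ξ.IsSymmetry σ)
    (φ : KP.Base → ℝ) (hφ : KP.IsSolution σ X φ)
    (U : Set KP.Base) (hU : IsOpen U) (hUX : closure U ⊆ X) (A : KP.CornerAtlas U) :
    A.boundaryIntegral
      (KP.pullback (KP.jet φ)
        (KP.contract η.jetGenerator (KP.contract ξ.jetGenerator (KP.Omega σ)))) = 0 :=
  theorem2p3_general hX (((KP.contDiff_Omega σ).of_le ENat.LEInfty.out).contDiffOn)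
    (fun z _ => KP.extDeriv_Omega σ z) η ξ
    (fun r s => hη _ (hξ φ hφ s) r) hU hUX A
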